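/- **Setting.** Let $n\ge k_0$, and let $V\in\mathbb C^{n\times k_0}$, $A\in\mathbb C^{n\times k}$, $P\in\mathbb C^{k_0\times k_0}$ with $$\delta_1=\lVert V^*V-I_{k_0}\rVert_2\le\tfrac13,\qquad \delta_2=\lVert P^*P-I_{k_0}\rVert_2\le\tfrac13 ,$$ and suppose that $T=(P-V_{1:k_0,:})^*P$ is nonsingular. Two-stage Householder-QR computes 1. $W\gets[P^*,0]^*-V$ and $T$; 2. $A\gets(I_n-WT^{-*}W^*)A$; 3. $S\gets P^*A_{1:k_0,:}$; 4. a QR factorization $A_{k_0+1:n,:}=\underline QR$; 5. $Q\gets(I_n-WT^{-1}W^*)[0,\underline Q^*]^*$. Hats denote computed values, and $\tilde A$ denotes the computed matrix that overwrites $A$ in step 2. In steps 2 and 5 the expression $(I_n-WM^{-1}W^*)B$ (with $M=T^*$ or $M=T$) is evaluated as $B-W(M^{-1}(W^*B))$, where $M^{-1}C$ is obtained by solving a linear system for each column of $C$. **Assumptions on the arithmetic.** Let $0\le\boldsymbol u<1$ and $\gamma_j=(1-\boldsymbol u)^{-j}-1$. Let $\epsilon_{\rm sv}(k_0)$, $\epsilon_T(k_0)$,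 $\epsilon_{\rm orth}(n-k_0,k)\le\frac13$ and $\epsilon_{\rm res}(n-k_0,k)\le1$ be nonnegative numbers (functions of $\boldsymbol u$ and of the indicated dimensions). * Every scalar operation outside the linear solves, the computation of $T$ and the inner QR factorization satisfies $\mathrm{fl}(a\circ b)=(a\circ b)(1+\delta)$ with $\delta\in\mathbb C$, $|\delta|\le\boldsymbol u$; inner products may be summed up in any order. * Each computed solution $\hat x$ of a system $Mx=b$ with $M\in\{\hat T,\hat T^*\}$ that occurs satisfies $(M+\Delta M)\hat x=b$ for some $\Delta M$ with $|\Delta M|\le\epsilon_{\rm sv}(k_0)|M|$ componentwise. * $\lVert\hat T-T\rVert_2\le\epsilon_T(k_0)$. * The computed inner QR factors satisfy $\lVert\underline{\hat Q}^*\underline{\hat Q}-I_k\rVert_2\le\epsilon_{\rm orth}(n-k_0,k)$ and $\lVert\tilde A_{k_0+1:n,:}-\underline{\hat Q}\hat R\rVert_2\le\epsilon_{\rm res}(n-k_0,k)\lVert\tilde A_{k_0+1:n,:}\rVert_2$. **Theorem.** Define $$\begin{aligned} \delta_T&=\epsilon_T(k_0)+3\sqrt{k_0}\,\epsilon_{\rm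 sv}(k_0)(1+\epsilon_T(k_0)),\qquad \delta=\delta_1+\delta_2,\\ \epsilon_1&=\delta+2\delta_T+16\sqrt{k_0}\,\gamma_{k_0+1}+8k_0\gamma_{k_0+1}^2,\\ \eta&=2\sqrt{\lVert T^{-1}\rVert_2^2\,\epsilon_1+\lVert T^{-1}\rVert_2},\\ \epsilon_2&=(\delta_T+8k_0\gamma_{k_0+1}^2)\eta^2+4\sqrt{2k_0}\,\gamma_{k_0+1}\eta,\\ \epsilon_3&=2\sqrt{2k_0}\,\gamma_{n+2k_0+1}\eta+\boldsymbol u\bigl(\sqrt{1+\delta\eta^2}+\epsilon_2\bigr),\qquad \epsilon_4=\epsilon_2+\epsilon_3 . \end{aligned}$$ If $\delta_T\lVert T^{-1}\rVert_2\le\frac12$, then $$\lVert\hat Q^*\hat Q-I\rVert_2\le\epsilon_{\rm orth}(n-k_0,k)+2\bigl(\delta\eta^2+2\sqrt{k(1+\delta\eta^2)}\,\epsilon_4+k\epsilon_4^2\bigr),$$ $$\lVert V^*\hat Q\rVert_{\mathsf F}\le\sqrt{2k}\,\bigl(2\sqrt{2k_0}\,\gamma_{k_0+1}+\epsilon_1\eta+\sqrt2\,\epsilon_3\bigr),$$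 $$\lVert A-\hat Q\hat R-V\hat S\rVert_2\le\Bigl(\delta\eta^2+\bigl(\sqrt{1+\delta\eta^2}+\sqrt k\,\epsilon_4\bigr)^2\bigl(\epsilon_{\rm res}(n-k_0,k)+\delta_2+3\sqrt k\,\epsilon_4+2k_0\gamma_{k_0}\bigr)\Bigr)\lVert A\rVert_2 .$$ None of these bounds depends on the condition number of $[V,A]$. Moreover $\eta=O(\sqrt{\kappa_2(T)})$, where $\kappa_2(T)=\lVert T\rVert_2\lVert T^{-1}\rVert_2$, in the following sense: if $0<c\le\lVert T\rVert_2$ and $\kappa_2(T)\,\epsilon_1\le c$, then $\eta\le2\sqrt{2/c}\,\sqrt{\kappa_2(T)}$. -/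

import Mathlib

open Matrix

/-- The spectral norm of a complex matrix (operator norm for Euclidean norms). -/
noncomputable def specNorm {ι κ : Type*} [Fintype ι] [Fintype κ] [DecidableEq κ]
    (M : Matrix ι κ ℂ) : ℝ :=
  @norm _ (Matrix.instL2OpNormedAddCommGroup (m := ι) (n := κ) (𝕜 := ℂ)).toNorm M

/-- The Frobenius norm of a complex matrix. -/
noncomputable def frobNorm {ι κ : Type*} [Fintype ι] [Fintype κ] (M : Matrix ι κ ℂ) : ℝ :=
  @norm _ (Matrix.frobeniusNormedAddCommGroup (m := ι) (n := κ) (α := ℂ)).toNorm M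

/-- The spectral condition number of a (nonsingular) square matrix. -/
noncomputable def specCond {ι : Type*} [Fintype ι] [DecidableEq ι] (M : Matrix ι ι ℂ) : ℝ :=
  specNorm M * specNorm M⁻¹

/-- The constant `γ_n = (1 - u)^{-n} - 1`. -/
noncomputable def gammaFl (u : ℝ) (n : ℕ) : ℝ := ((1 - u) ^ n)⁻¹ - 1

/-- The standard rounding model: `y` is an admissible computed value of an elementary operation
whose exact result is `x`, i.e. `y = x (1 + δ)` with `|δ| ≤ u`. -/
def IsRounded (u : ℝ) (x y : ℂ) : Prop := ∃ δ : ℂ, ‖δ‖ ≤ u ∧ y = x * (1 + δ)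

/-- `IsFlSum u p s z`: the number `z` is an admissible computed value of `∑ i ∈ s, p i`, where the
terms are added pairwise, in any order and with any bracketing, each addition being rounded.
The empty sum and a sum with one term need no addition. -/
inductive IsFlSum {ι : Type*} (u : ℝ) (p : ι → ℂ) : Finset ι → ℂ → Prop
  | empty : IsFlSum u p ∅ 0
  | single (i : ι) : IsFlSum u p {i} (p i)
  | add {s t : Finset ι} (hst : Disjoint s t) {x y z : ℂ} (hs : s.Nonempty) (ht : t.Nonempty)
      (hx : IsFlSum u p s x) (hy : IsFlSum u p t y) (hz : IsRounded u (x + y) z) :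
      IsFlSum u p (s.disjUnion t hst) z

/-- `z` is an admissible computed value of `∑ i, x i * y i`: all products are rounded, and then
summed up in floating point. -/
def IsFlDot {ι : Type*} [Fintype ι] (u : ℝ) (x y : ι → ℂ) (z : ℂ) : Prop :=
  ∃ p : ι → ℂ, (∀ i, IsRounded u (x i * y i) (p i)) ∧ IsFlSum u p Finset.univ z

/-- `Z` is an admissible computed value of the matrix product `X * Y` (by inner products). -/
def IsFlMul {ι κ μ : Type*} [Fintype κ] (u : ℝ) (X : Matrix ι κ ℂ) (Y : Matrix κ μ ℂ)
    (Z : Matrix ι μ ℂ) : Prop :=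
  ∀ i j, IsFlDot u (fun l => X i l) (fun l => Y l j) (Z i j)

/-- `Z` is an admissible computed value of the difference `X - Y`. -/
def IsFlSub {ι κ : Type*} (u : ℝ) (X Y Z : Matrix ι κ ℂ) : Prop :=
  ∀ i j, IsRounded u (X i j - Y i j) (Z i j)

/-- The error bound for linear solves: every column `d` of `D` is the computed solution of
`M d = c`, with `c` the corresponding column of `C`, in the sense that `(M + ΔM) d = c` for some
`ΔM` (which may depend on the column) with `|ΔM| ≤ ε |M|` componentwise. -/
def SolveErrorBound {ι κ : Type*} [Fintype ι] (ε : ℝ) (M : Matrix ι ι ℂ) (C D : Matrix ι κ ℂ) :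
    Prop :=
  ∀ j, ∃ ΔM : Matrix ι ι ℂ, (∀ a b, ‖ΔM a b‖ ≤ ε * ‖M a b‖) ∧
    (M + ΔM) *ᵥ (fun a => D a j) = fun a => C a j

/-- `Z` is an admissible computed value of `(I - W M⁻¹ Wᴴ) B`, evaluated as
`C ← Wᴴ B`, solve `M D = C`, `E ← W D`, `Z ← B - E`. -/
def IsFlApply {ι κ μ : Type*} [Fintype ι] [Fintype κ] (u εsv : ℝ) (W : Matrix ι κ ℂ)
    (M : Matrix κ κ ℂ) (B Z : Matrix ι μ ℂ) : Prop :=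
  ∃ (C D : Matrix κ μ ℂ) (E : Matrix ι μ ℂ),
    IsFlMul u Wᴴ B C ∧ SolveErrorBound εsv M C D ∧ IsFlMul u W D E ∧ IsFlSub u B E Z

/-- The error bounds for computed factors `Q`, `R` of a QR factorization of `B`. (The triangular
shape of `R` plays no role for them, so it is not demanded.) -/
def QRErrorBounds {ι κ : Type*} [Fintype ι] [Fintype κ] [DecidableEq κ] (εorth εres : ℝ)
    (B Q : Matrix ι κ ℂ) (R : Matrix κ κ ℂ) : Prop :=
  specNorm (Qᴴ * Q - 1) ≤ εorth ∧ specNorm (B - Q * R) ≤ εres * specNorm B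

/-- The exact kernel matrix `T = (P - V_{1:k₀,:})ᴴ P`. Matrices with `n = k₀ + m` rows are indexed
by `Fin k₀ ⊕ Fin m`, so that `toRows₁` takes the rows `1:k₀` and `toRows₂` the rows `k₀+1:n`. -/
def kernelT {k₀ m : ℕ} (P : Matrix (Fin k₀) (Fin k₀) ℂ)
    (V : Matrix (Fin k₀ ⊕ Fin m) (Fin k₀) ℂ) : Matrix (Fin k₀) (Fin k₀) ℂ :=
  (P - V.toRows₁)ᴴ * P

/-- A floating-point run of two-stage Householder-QR on `V`, `A` with the chosen matrix `P`.
The hatted matrices are the computed values of `W`, `T`, `S`, `Q`, `R`; `A'` is the computed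
matrix that overwrites `A`, and `Qs` is the computed orthonormal factor of the inner QR
factorization. -/
structure IsTwoStageHouseholderRun {k₀ m k : ℕ} (u εsv εT εorth εres : ℝ)
    (V : Matrix (Fin k₀ ⊕ Fin m) (Fin k₀) ℂ) (A : Matrix (Fin k₀ ⊕ Fin m) (Fin k) ℂ)
    (P : Matrix (Fin k₀) (Fin k₀) ℂ)
    (What : Matrix (Fin k₀ ⊕ Fin m) (Fin k₀) ℂ) (That : Matrix (Fin k₀) (Fin k₀) ℂ)
    (A' : Matrix (Fin k₀ ⊕ Fin m) (Fin k) ℂ) (Shat : Matrix (Fin k₀) (Fin k) ℂ)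
    (Qs : Matrix (Fin m) (Fin k) ℂ) (Rhat : Matrix (Fin k) (Fin k) ℂ)
    (Qhat : Matrix (Fin k₀ ⊕ Fin m) (Fin k) ℂ) : Prop where
  /-- `W ← [Pᴴ, 0]ᴴ - V`. -/
  computeW : IsFlSub u (Matrix.fromRows P 0) V What
  /-- `T ← (P - V_{1:k₀,:})ᴴ P`, by any method with error at most `εT`. -/
  computeT : specNorm (That - kernelT P V) ≤ εT
  /-- `A ← (I - W T^{-*} Wᴴ) A`. -/
  updateA : IsFlApply u εsv What Thatᴴ A A'
  /-- `S ← Pᴴ A_{1:k₀,:}`. -/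
  computeS : IsFlMul u Pᴴ A'.toRows₁ Shat
  /-- QR factorization of `A_{k₀+1:n,:}`. -/
  innerQR : QRErrorBounds εorth εres A'.toRows₂ Qs Rhat
  /-- `Q ← (I - W T⁻¹ Wᴴ) [0, Qsᴴ]ᴴ`. -/
  computeQ : IsFlApply u εsv What That (Matrix.fromRows 0 Qs) Qhat

/-! Put X = [P; 0], so that W = X - V and T = Wᴴ X. The exact reflector H = I - W T⁻¹ Wᴴ sends X to
V, and the defect Wᴴ W - T - Tᴴ equals Vᴴ V - Xᴴ X, of norm at most δ (`norm_gram_sub_kernel_le`).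
Two identities exploit this. With Y = T⁻¹ Wᴴ, Hᴴ H - I = Yᴴ (defect) Y
(`norm_blockReflector_gram_le`); and the Gram matrix of W T⁻¹ is T⁻ᴴ (defect) T⁻¹ + T⁻¹ + T⁻ᴴ
(`norm_mul_inv_sq_le`). The latter, applied to Tᴴ, bounds ‖Y‖² by ‖T⁻¹‖² δ + 2‖T⁻¹‖, whence η =
O(√κ₂(T)). Only T and its perturbations are inverted, so the conditioning of [V, A] never enters.

In floating point the columns are treated one by one. Up to a relative error ε₃, a computed column
is the image of the input column under a reflector with perturbed W' and M'
(`IsFlApply.exists_blockReflector`). The perturbed defect is at most ε₁ and the inverse at most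
doubles, so the same η serves, and the perturbed reflector is within ε₂ of H. Orthogonality and
residual follow by comparison with H (`norm_gram_sub_one_le_of_perturbed`,
`norm_two_stage_residual_le`). For Vᴴ Q̂ the perturbed reflector is used directly
(`norm_conjTranspose_mul_blockReflector_mul_le`), so that ε₂, quadratic in η, gives way to a term
linear in η. -/

open scoped Matrix.Norms.L2Operator
set_option linter.unusedSectionVars false

/-! ### Spectral and Frobenius norms, columns, nearly orthonormal matrices. -/

section Norms

variable {ι κ μ : Type*} [Fintype ι] [Fintype κ] [Fintype μ]
  [DecidableEq ι] [DecidableEq κ] [DecidableEq μ]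

/-- The `j`-th column of a matrix, as a matrix with one column. -/
def colMat {ι κ : Type*} (M : Matrix ι κ ℂ) (j : κ) : Matrix ι Unit ℂ :=
  M.submatrix id (fun _ => j)

theorem colMat_mul (X : Matrix ι κ ℂ) (Y : Matrix κ μ ℂ) (j : μ) :
    colMat (X * Y) j = X * colMat Y j := by
  ext a b
  simp [colMat, Matrix.mul_apply]

theorem colMat_sub (X Y : Matrix ι κ ℂ) (j : κ) :
    colMat (X - Y) j = colMat X j - colMat Y j := rfl

theorem frobNorm_nonneg (M : Matrix ι κ ℂ) : 0 ≤ frobNorm M :=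
  @norm_nonneg _ (Matrix.frobeniusNormedAddCommGroup
    (m := ι) (n := κ) (α := ℂ)).toSeminormedAddCommGroup.toSeminormedAddGroup M

theorem frobNorm_eq_sqrt (M : Matrix ι κ ℂ) : frobNorm M = √(∑ i, ∑ j, ‖M i j‖ ^ 2) := by
  rw [frobNorm, Matrix.frobenius_norm_def, Real.sqrt_eq_rpow]
  simp

theorem frobNorm_sq (M : Matrix ι κ ℂ) : frobNorm M ^ 2 = ∑ i, ∑ j, ‖M i j‖ ^ 2 := by
  rw [frobNorm_eq_sqrt, Real.sq_sqrt (by positivity)]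

theorem frobNorm_mul_le (X : Matrix ι κ ℂ) (Y : Matrix κ μ ℂ) :
    frobNorm (X * Y) ≤ frobNorm X * frobNorm Y :=
  Matrix.frobenius_norm_mul X Y

theorem frobNorm_replicateCol (v : ι → ℂ) :
    frobNorm (replicateCol Unit v) = ‖(WithLp.toLp 2 v : EuclideanSpace ℂ ι)‖ :=
  Matrix.frobenius_norm_replicateCol v

theorem norm_le_frobNorm (M : Matrix ι κ ℂ) : ‖M‖ ≤ frobNorm M := by
  rw [Matrix.l2_opNorm_def]
  refine ContinuousLinearMap.opNorm_le_bound _ (frobNorm_nonneg M) fun x => ?_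
  have h := frobNorm_mul_le M (replicateCol Unit x.ofLp)
  rw [← Matrix.replicateCol_mulVec, frobNorm_replicateCol, frobNorm_replicateCol] at h
  exact h

/-- On single columns a componentwise bound therefore passes to the spectral norm without a
dimension factor. -/
theorem norm_eq_frobNorm_of_unit (X : Matrix ι Unit ℂ) : ‖X‖ = frobNorm X := by
  refine le_antisymm (norm_le_frobNorm X) ?_
  have h := Matrix.l2_opNorm_mulVec X (WithLp.toLp 2 (fun _ : Unit => (1 : ℂ)))
  have h1 : ‖(WithLp.toLp 2 (fun _ : Unit => (1 : ℂ)) : EuclideanSpace ℂ Unit)‖ = 1 := by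
    simp [EuclideanSpace.norm_eq]
  rw [h1, mul_one] at h
  refine le_trans (le_of_eq ?_) h
  rw [frobNorm_eq_sqrt, EuclideanSpace.norm_eq]
  simp [Matrix.mulVec, dotProduct]

theorem frobNorm_sq_eq_sum_colMat (M : Matrix ι κ ℂ) :
    frobNorm M ^ 2 = ∑ j, ‖colMat M j‖ ^ 2 := by
  rw [frobNorm_sq, Finset.sum_comm]
  refine Finset.sum_congr rfl fun j _ => ?_
  rw [norm_eq_frobNorm_of_unit, frobNorm_sq]
  simp [colMat]

theorem norm_one_le_one : ‖(1 : Matrix ι ι ℂ)‖ ≤ 1 := by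
  rw [← Matrix.diagonal_one, Matrix.l2_opNorm_diagonal]
  exact (pi_norm_le_iff_of_nonneg zero_le_one).2 fun i => by simp

theorem norm_colMat_le (M : Matrix ι κ ℂ) (j : κ) : ‖colMat M j‖ ≤ ‖M‖ := by
  have h : colMat M j = M * colMat (1 : Matrix κ κ ℂ) j := by rw [← colMat_mul, Matrix.mul_one]
  have h1 : ‖colMat (1 : Matrix κ κ ℂ) j‖ = 1 := by
    rw [norm_eq_frobNorm_of_unit, frobNorm_eq_sqrt]
    simp [colMat, Matrix.one_apply, apply_ite]
  calc ‖colMat M j‖ ≤ ‖M‖ * ‖colMat (1 : Matrix κ κ ℂ) j‖ := by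
        conv_lhs => rw [h]
        exact Matrix.l2_opNorm_mul _ _
    _ = ‖M‖ := by rw [h1, mul_one]

theorem frobNorm_le_sqrt_card_mul_norm (M : Matrix ι κ ℂ) :
    frobNorm M ≤ √(Fintype.card κ) * ‖M‖ := by
  refine le_of_pow_le_pow_left₀ two_ne_zero (by positivity) ?_
  rw [frobNorm_sq_eq_sum_colMat, mul_pow, Real.sq_sqrt (by positivity)]
  calc ∑ j, ‖colMat M j‖ ^ 2 ≤ ∑ _j : κ, ‖M‖ ^ 2 :=
        Finset.sum_le_sum fun j _ => by gcongr; exact norm_colMat_le M j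
    _ = _ := by simp

theorem frobNorm_conjTranspose (M : Matrix ι κ ℂ) : frobNorm Mᴴ = frobNorm M :=
  Matrix.frobenius_norm_conjTranspose M

theorem frobNorm_le_sqrt_card_mul_norm' (M : Matrix ι κ ℂ) :
    frobNorm M ≤ √(Fintype.card ι) * ‖M‖ := by
  rw [← frobNorm_conjTranspose, ← Matrix.l2_opNorm_conjTranspose]
  exact frobNorm_le_sqrt_card_mul_norm Mᴴ

theorem frobNorm_le_of_forall_norm_le {c : ℝ} (hc : 0 ≤ c) {X Y : Matrix ι κ ℂ}
    (h : ∀ i j, ‖X i j‖ ≤ c * ‖Y i j‖) : frobNorm X ≤ c * frobNorm Y := by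
  refine le_of_pow_le_pow_left₀ two_ne_zero (mul_nonneg hc (frobNorm_nonneg Y)) ?_
  rw [mul_pow, frobNorm_sq, frobNorm_sq, Finset.mul_sum]
  refine Finset.sum_le_sum fun i _ => ?_
  rw [Finset.mul_sum]
  refine Finset.sum_le_sum fun j _ => ?_
  rw [← mul_pow]
  gcongr
  exact h i j

/-- Backward errors differ from column to column; the squared Frobenius norm is additive over
columns and so can collect them. -/
theorem frobNorm_le_of_forall_colMat {ν : Type*} [Fintype ν] [DecidableEq ν] {c : ℝ} (hc : 0 ≤ c)
    {X : Matrix ι κ ℂ} {Y : Matrix ν κ ℂ}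
    (h : ∀ j, ‖colMat X j‖ ≤ c * ‖colMat Y j‖) : frobNorm X ≤ c * frobNorm Y := by
  refine le_of_pow_le_pow_left₀ two_ne_zero (mul_nonneg hc (frobNorm_nonneg Y)) ?_
  rw [mul_pow, frobNorm_sq_eq_sum_colMat, frobNorm_sq_eq_sum_colMat, Finset.mul_sum]
  refine Finset.sum_le_sum fun j _ => ?_
  rw [← mul_pow]
  gcongr
  exact h j

theorem norm_le_of_forall_norm_le {c : ℝ} (hc : 0 ≤ c) {X Y : Matrix ι κ ℂ}
    (h : ∀ i j, ‖X i j‖ ≤ c * ‖Y i j‖) : ‖X‖ ≤ c * (√(Fintype.card κ) * ‖Y‖) :=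
  (norm_le_frobNorm X).trans <| (frobNorm_le_of_forall_norm_le hc h).trans <|
    mul_le_mul_of_nonneg_left (frobNorm_le_sqrt_card_mul_norm Y) hc

theorem norm_le_of_forall_colMat {ν : Type*} [Fintype ν] [DecidableEq ν] {c : ℝ} (hc : 0 ≤ c)
    {X : Matrix ι κ ℂ} {Y : Matrix ν κ ℂ}
    (h : ∀ j, ‖colMat X j‖ ≤ c * ‖colMat Y j‖) : ‖X‖ ≤ c * (√(Fintype.card κ) * ‖Y‖) :=
  (norm_le_frobNorm X).trans <| (frobNorm_le_of_forall_colMat hc h).trans <|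
    mul_le_mul_of_nonneg_left (frobNorm_le_sqrt_card_mul_norm Y) hc

theorem norm_col_le_of_forall_norm_le {c : ℝ} (hc : 0 ≤ c) {X Y : Matrix ι Unit ℂ}
    (h : ∀ i j, ‖X i j‖ ≤ c * ‖Y i j‖) : ‖X‖ ≤ c * ‖Y‖ := by
  rw [norm_eq_frobNorm_of_unit, norm_eq_frobNorm_of_unit]
  exact frobNorm_le_of_forall_norm_le hc h

/-- The two Gram matrices of a square matrix deviate from the identity by the same amount. -/
theorem norm_mul_conjTranspose_sub_one {P : Matrix ι ι ℂ} (hP : IsUnit P) :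
    ‖P * Pᴴ - 1‖ = ‖Pᴴ * P - 1‖ := by
  obtain ⟨p, rfl⟩ := hP
  have h1 : IsSelfAdjoint ((p : Matrix ι ι ℂ) * (p : Matrix ι ι ℂ)ᴴ - 1) :=
    (IsSelfAdjoint.mul_star_self (p : Matrix ι ι ℂ)).sub (IsSelfAdjoint.one _)
  have h2 : IsSelfAdjoint ((p : Matrix ι ι ℂ)ᴴ * (p : Matrix ι ι ℂ) - 1) :=
    (IsSelfAdjoint.star_mul_self (p : Matrix ι ι ℂ)).sub (IsSelfAdjoint.one _)
  -- The two deviations are similar via P, and both are self-adjoint, so each norm is a spectral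
  -- radius and these agree.
  have h3 : (p : Matrix ι ι ℂ) * (p : Matrix ι ι ℂ)ᴴ - 1
      = p * ((p : Matrix ι ι ℂ)ᴴ * (p : Matrix ι ι ℂ) - 1) * (↑p⁻¹ : Matrix ι ι ℂ) := by
    simp [mul_sub, sub_mul, mul_assoc]
  have h4 := h1.spectralRadius_eq_nnnorm
  rw [h3, spectralRadius, spectrum.units_conjugate, ← spectralRadius,
    h2.spectralRadius_eq_nnnorm, ← h3] at h4
  exact congrArg NNReal.toReal (ENNReal.coe_injective h4).symm

theorem isUnit_of_norm_conjTranspose_mul_self_sub_one {P : Matrix ι ι ℂ}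
    (h : ‖Pᴴ * P - 1‖ < 1) : IsUnit P := by
  have h1 : IsUnit (1 - (1 - Pᴴ * P)) := isUnit_one_sub_of_norm_lt_one (by rwa [norm_sub_rev])
  rw [sub_sub_cancel, Matrix.isUnit_iff_isUnit_det, Matrix.det_mul] at h1
  exact (Matrix.isUnit_iff_isUnit_det _).2 (isUnit_of_mul_isUnit_right h1)

theorem norm_sq_le_of_gram {X : Matrix ι κ ℂ} {d : ℝ} (h : ‖Xᴴ * X - 1‖ ≤ d) :
    ‖X‖ ^ 2 ≤ 1 + d := by
  rw [sq, ← Matrix.l2_opNorm_conjTranspose_mul_self]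
  calc ‖Xᴴ * X‖ = ‖1 + (Xᴴ * X - 1)‖ := by rw [add_sub_cancel]
    _ ≤ ‖(1 : Matrix κ κ ℂ)‖ + ‖Xᴴ * X - 1‖ := norm_add_le _ _
    _ ≤ 1 + d := add_le_add norm_one_le_one h

theorem norm_le_of_gram {X : Matrix ι κ ℂ} {d : ℝ} (h : ‖Xᴴ * X - 1‖ ≤ d) :
    ‖X‖ ≤ √(1 + d) :=
  Real.le_sqrt_of_sq_le (norm_sq_le_of_gram h)

/-- A matrix with nearly orthonormal columns shrinks a factor by at most `√(1 - d)`. -/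
theorem norm_sq_le_norm_mul_sq {X : Matrix ι κ ℂ} {d : ℝ} (h : ‖Xᴴ * X - 1‖ ≤ d)
    (R : Matrix κ μ ℂ) : (1 - d) * ‖R‖ ^ 2 ≤ ‖X * R‖ ^ 2 := by
  have h1 : Rᴴ * R = (X * R)ᴴ * (X * R) - Rᴴ * ((Xᴴ * X - 1) * R) := by
    simp [Matrix.conjTranspose_mul, Matrix.mul_assoc, Matrix.sub_mul, Matrix.mul_sub]
  have h2 : ‖R‖ ^ 2 ≤ ‖X * R‖ ^ 2 + ‖R‖ * (d * ‖R‖) := by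
    rw [sq, sq, ← Matrix.l2_opNorm_conjTranspose_mul_self,
      ← Matrix.l2_opNorm_conjTranspose_mul_self, h1]
    refine (norm_sub_le _ _).trans (add_le_add le_rfl ?_)
    refine (Matrix.l2_opNorm_mul _ _).trans ?_
    rw [Matrix.l2_opNorm_conjTranspose]
    gcongr
    exact (Matrix.l2_opNorm_mul _ _).trans (by gcongr)
  nlinarith

theorem norm_isometry_le_one {E : Matrix ι κ ℂ} (h : Eᴴ * E = 1) : ‖E‖ ≤ 1 := by
  have := norm_sq_le_of_gram (X := E) (d := 0) (by simp [h])
  nlinarith [norm_nonneg E]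

theorem norm_isometry_mul {E : Matrix ι κ ℂ} (h : Eᴴ * E = 1) (X : Matrix κ μ ℂ) :
    ‖E * X‖ = ‖X‖ := by
  have h1 : ‖E * X‖ ^ 2 = ‖X‖ ^ 2 := by
    rw [sq, sq, ← Matrix.l2_opNorm_conjTranspose_mul_self,
      ← Matrix.l2_opNorm_conjTranspose_mul_self, Matrix.conjTranspose_mul, Matrix.mul_assoc,
      ← Matrix.mul_assoc Eᴴ, h, Matrix.one_mul]
  exact (sq_eq_sq₀ (norm_nonneg _) (norm_nonneg _)).1 h1

theorem norm_conjTranspose_isometry_mul_le {E : Matrix ι κ ℂ} (h : Eᴴ * E = 1)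
    (X : Matrix ι μ ℂ) : ‖Eᴴ * X‖ ≤ ‖X‖ := by
  refine (Matrix.l2_opNorm_mul _ _).trans ?_
  rw [Matrix.l2_opNorm_conjTranspose]
  exact mul_le_of_le_one_left (norm_nonneg _) (norm_isometry_le_one h)

end Norms

/-! ### Rounding errors of sums, inner products, matrix products and solves. -/

section Rounding

theorem gammaFl_nonneg {u : ℝ} (hu0 : 0 ≤ u) (hu1 : u < 1) (n : ℕ) : 0 ≤ gammaFl u n :=
  sub_nonneg.2 ((one_le_inv₀ (pow_pos (sub_pos.2 hu1) n)).2
    (pow_le_one₀ (sub_nonneg.2 hu1.le) (sub_le_self 1 hu0)))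

/-- Since 1 + γ_n = (1 - u)⁻ⁿ is multiplicative in n, compounding errors γ_a and γ_b gives exactly
γ_{a+b}. -/
theorem gammaFl_add (u : ℝ) (a b : ℕ) :
    gammaFl u (a + b) = gammaFl u a + gammaFl u b + gammaFl u a * gammaFl u b := by
  simp only [gammaFl, pow_add, mul_inv]
  ring

theorem gammaFl_add_le {u : ℝ} (hu0 : 0 ≤ u) (hu1 : u < 1) (a b : ℕ) :
    gammaFl u a + gammaFl u b ≤ gammaFl u (a + b) := by
  rw [gammaFl_add]
  have := mul_nonneg (gammaFl_nonneg hu0 hu1 a) (gammaFl_nonneg hu0 hu1 b)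
  linarith

theorem gammaFl_mono {u : ℝ} (hu0 : 0 ≤ u) (hu1 : u < 1) {a b : ℕ} (h : a ≤ b) :
    gammaFl u a ≤ gammaFl u b := by
  obtain ⟨c, rfl⟩ := Nat.exists_eq_add_of_le h
  have := gammaFl_add_le hu0 hu1 a c
  have := gammaFl_nonneg hu0 hu1 c
  linarith

theorem le_gammaFl_one {u : ℝ} (hu0 : 0 ≤ u) (hu1 : u < 1) : u ≤ gammaFl u 1 := by
  have h : 0 < 1 - u := sub_pos.2 hu1
  rw [gammaFl, pow_one, le_sub_iff_add_le, ← one_div, le_div_iff₀ h]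
  nlinarith

theorem add_gammaFl_le {u : ℝ} (hu0 : 0 ≤ u) (hu1 : u < 1) (a : ℕ) :
    gammaFl u a + u * (1 + gammaFl u a) ≤ gammaFl u (a + 1) := by
  rw [gammaFl_add]
  nlinarith [le_gammaFl_one hu0 hu1, gammaFl_nonneg hu0 hu1 a]

theorem norm_one_add_mul_one_add_sub_one_le {θ φ : ℂ} {a b : ℝ} (hθ : ‖θ‖ ≤ a) (hφ : ‖φ‖ ≤ b) :
    ‖(1 + θ) * (1 + φ) - 1‖ ≤ a + b + a * b := by
  have ha : 0 ≤ a := (norm_nonneg _).trans hθ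
  calc ‖(1 + θ) * (1 + φ) - 1‖ = ‖θ + φ + θ * φ‖ := by congr 1; ring
    _ ≤ ‖θ‖ + ‖φ‖ + ‖θ * φ‖ := norm_add₃_le
    _ ≤ a + b + a * b := by rw [norm_mul]; gcongr

/-- In any bracketing of a nonempty sum, a term passes through at most card - 1 additions. -/
theorem IsFlSum.exists_backward {ι : Type*} {u : ℝ} (hu0 : 0 ≤ u) (hu1 : u < 1)
    {p : ι → ℂ} {s : Finset ι} {z : ℂ} (h : IsFlSum u p s z) :
    ∃ θ : ι → ℂ, (∀ i, ‖θ i‖ ≤ gammaFl u (s.card - 1)) ∧ z = ∑ i ∈ s, p i * (1 + θ i) := by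
  classical
  induction h with
  | empty => exact ⟨0, fun i => by simp [gammaFl], by simp⟩
  | single i => exact ⟨0, fun i => by simp [gammaFl], by simp⟩
  | @add s t hst x y z hs ht hx hy hz ihx ihy =>
    obtain ⟨θ, hθ, rfl⟩ := ihx
    obtain ⟨φ, hφ, rfl⟩ := ihy
    obtain ⟨ε, hε, rfl⟩ := hz
    have hs1 : 1 ≤ s.card := hs.card_pos
    have ht1 : 1 ≤ t.card := ht.card_pos
    have hε' := hε.trans (le_gammaFl_one hu0 hu1)
    refine ⟨fun i => (1 + if i ∈ s then θ i else φ i) * (1 + ε) - 1, fun i => ?_, ?_⟩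
    · rw [Finset.card_disjUnion]
      -- Room for one more rounding exists because the other summand set is nonempty.
      have key : ∀ (a : ℕ) (ψ : ℂ), ‖ψ‖ ≤ gammaFl u a → a + 1 ≤ s.card + t.card - 1 →
          ‖(1 + ψ) * (1 + ε) - 1‖ ≤ gammaFl u (s.card + t.card - 1) := fun a ψ hψ ha =>
        ((norm_one_add_mul_one_add_sub_one_le hψ hε').trans_eq (gammaFl_add u a 1).symm).trans
          (gammaFl_mono hu0 hu1 ha)
      by_cases hi : i ∈ s
      · simpa [hi] using key _ _ (hθ i) (by omega)
      · simpa [hi] using key _ _ (hφ i) (by omega)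
    · rw [Finset.sum_disjUnion, add_mul, Finset.sum_mul, Finset.sum_mul]
      congr 1
      · refine Finset.sum_congr rfl fun i hi => ?_
        simp only [hi, if_true]
        ring
      · refine Finset.sum_congr rfl fun i hi => ?_
        simp only [Finset.disjoint_right.1 hst hi, if_false]
        ring

theorem IsFlDot.exists_backward {ι : Type*} [Fintype ι] {u : ℝ} (hu0 : 0 ≤ u) (hu1 : u < 1)
    {x y : ι → ℂ} {z : ℂ} (h : IsFlDot u x y z) :
    ∃ θ : ι → ℂ, (∀ i, ‖θ i‖ ≤ gammaFl u (Fintype.card ι)) ∧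
      z = ∑ i, x i * (1 + θ i) * y i := by
  obtain ⟨p, hp, hs⟩ := h
  obtain ⟨θ, hθ, rfl⟩ := hs.exists_backward hu0 hu1
  choose ε hε hpε using hp
  refine ⟨fun i => (1 + θ i) * (1 + ε i) - 1, fun i => ?_, Finset.sum_congr rfl fun i _ => ?_⟩
  · have h1 : 1 ≤ Fintype.card ι := Fintype.card_pos_iff.2 ⟨i⟩
    refine ((norm_one_add_mul_one_add_sub_one_le (hθ i)
      ((hε i).trans (le_gammaFl_one hu0 hu1))).trans_eq (gammaFl_add u _ 1).symm).trans_eq ?_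
    rw [Finset.card_univ, Nat.sub_add_cancel h1]
  · rw [hpε i]
    ring

/-- Columnwise backward error of a computed matrix product. -/
theorem IsFlMul.exists_backward {ι κ μ : Type*} [Fintype κ] {u : ℝ} (hu0 : 0 ≤ u) (hu1 : u < 1)
    {X : Matrix ι κ ℂ} {Y : Matrix κ μ ℂ} {Z : Matrix ι μ ℂ} (h : IsFlMul u X Y Z) (j : μ) :
    ∃ Θ : Matrix ι κ ℂ, (∀ i l, ‖Θ i l‖ ≤ gammaFl u (Fintype.card κ)) ∧
      colMat Z j = (Matrix.of fun i l => X i l * (1 + Θ i l)) * colMat Y j := by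
  choose θ hθ hz using fun i => (h i j).exists_backward hu0 hu1
  refine ⟨Matrix.of θ, fun i l => hθ i l, ?_⟩
  ext i a
  simp [colMat, Matrix.mul_apply, hz]

/-- Columnwise residual form of the error bound for linear solves. -/
theorem SolveErrorBound.exists_backward {ι κ : Type*} [Fintype ι] {ε : ℝ} {M : Matrix ι ι ℂ}
    {C D : Matrix ι κ ℂ} (h : SolveErrorBound ε M C D) (j : κ) :
    ∃ N : Matrix ι ι ℂ, (∀ a b, ‖N a b‖ ≤ ε * ‖M a b‖) ∧ (M + N) * colMat D j = colMat C j := by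
  obtain ⟨N, hN, hx⟩ := h j
  refine ⟨N, hN, ?_⟩
  ext a b
  exact congrFun hx a

end Rounding

/-! ### Exact block reflectors and their perturbation. -/

section Reflector

variable {ι κ μ : Type*} [Fintype ι] [Fintype κ] [Fintype μ]
  [DecidableEq ι] [DecidableEq κ] [DecidableEq μ]

theorem specNorm_mul_le_of_le {X : Matrix ι κ ℂ} {Y : Matrix κ μ ℂ} {a b : ℝ} (hX : ‖X‖ ≤ a)
    (hY : ‖Y‖ ≤ b) : ‖X * Y‖ ≤ a * b :=
  (Matrix.l2_opNorm_mul X Y).trans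
    (mul_le_mul hX hY (norm_nonneg _) ((norm_nonneg _).trans hX))

theorem norm_conjTranspose_le {X : Matrix ι κ ℂ} {a : ℝ} (hX : ‖X‖ ≤ a) : ‖Xᴴ‖ ≤ a := by
  rwa [Matrix.l2_opNorm_conjTranspose]

/-- The block reflector `I - W M⁻¹ Wᴴ`. -/
noncomputable def blockReflector (W : Matrix ι κ ℂ) (M : Matrix κ κ ℂ) : Matrix ι ι ℂ :=
  1 - W * (M⁻¹ * Wᴴ)

theorem blockReflector_conjTranspose (W : Matrix ι κ ℂ) (M : Matrix κ κ ℂ) :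
    (blockReflector W M)ᴴ = blockReflector W Mᴴ := by
  simp [blockReflector, Matrix.conjTranspose_sub, Matrix.conjTranspose_mul, Matrix.mul_assoc,
    Matrix.conjTranspose_nonsing_inv]

theorem isUnit_conjTranspose {M : Matrix κ κ ℂ} (hM : IsUnit M) : IsUnit Mᴴ :=
  hM.star

theorem norm_inv_conjTranspose (M : Matrix κ κ ℂ) : ‖Mᴴ⁻¹‖ = ‖M⁻¹‖ := by
  rw [← Matrix.conjTranspose_nonsing_inv, Matrix.l2_opNorm_conjTranspose]

/-- The defect is blind to M ↔ Mᴴ, so the analysis for T also covers the update of A, which uses Tᴴ.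
-/
theorem norm_gram_sub_conjTranspose (W : Matrix ι κ ℂ) (M : Matrix κ κ ℂ) :
    ‖Wᴴ * W - Mᴴ - Mᴴᴴ‖ = ‖Wᴴ * W - M - Mᴴ‖ := by
  rw [Matrix.conjTranspose_conjTranspose, sub_right_comm]

/-- Splitting Wᴴ W into defect + M + Mᴴ makes the main term linear in ‖M⁻¹‖; bounding ‖W‖ and ‖M⁻¹‖
separately would make it quadratic. -/
theorem norm_mul_inv_sq_le {W : Matrix ι κ ℂ} {M : Matrix κ κ ℂ} {ε τ : ℝ} (hM : IsUnit M)
    (hE : ‖Wᴴ * W - M - Mᴴ‖ ≤ ε) (hτ : ‖M⁻¹‖ ≤ τ) : ‖W * M⁻¹‖ ^ 2 ≤ τ ^ 2 * ε + 2 * τ := by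
  have hdet := (Matrix.isUnit_iff_isUnit_det M).1 hM
  have h1 : M * M⁻¹ = 1 := Matrix.mul_nonsing_inv M hdet
  have h2 : M⁻¹ᴴ * (Mᴴ * M⁻¹) = M⁻¹ := by
    rw [← Matrix.mul_assoc, ← Matrix.conjTranspose_mul, h1, Matrix.conjTranspose_one,
      Matrix.one_mul]
  have h3 : (W * M⁻¹)ᴴ * (W * M⁻¹)
      = M⁻¹ᴴ * ((Wᴴ * W - M - Mᴴ) * M⁻¹) + (M⁻¹ᴴ + M⁻¹) := by
    simp only [Matrix.conjTranspose_mul, Matrix.mul_sub, Matrix.sub_mul, Matrix.mul_assoc, h1, h2,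
      Matrix.mul_one]
    abel
  rw [sq, ← Matrix.l2_opNorm_conjTranspose_mul_self, h3]
  have h4 := norm_conjTranspose_le hτ
  calc _ ≤ ‖M⁻¹ᴴ * ((Wᴴ * W - M - Mᴴ) * M⁻¹)‖ + (‖M⁻¹ᴴ‖ + ‖M⁻¹‖) :=
        (norm_add_le _ _).trans (add_le_add le_rfl (norm_add_le _ _))
    _ ≤ τ * (ε * τ) + (τ + τ) :=
        add_le_add (specNorm_mul_le_of_le h4 (specNorm_mul_le_of_le hE hτ)) (add_le_add h4 hτ)
    _ = τ ^ 2 * ε + 2 * τ := by ring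

theorem norm_inv_mul_conjTranspose_sq_le {W : Matrix ι κ ℂ} {M : Matrix κ κ ℂ} {ε τ : ℝ}
    (hM : IsUnit M) (hE : ‖Wᴴ * W - M - Mᴴ‖ ≤ ε) (hτ : ‖M⁻¹‖ ≤ τ) :
    ‖M⁻¹ * Wᴴ‖ ^ 2 ≤ τ ^ 2 * ε + 2 * τ := by
  have h := norm_mul_inv_sq_le (isUnit_conjTranspose hM)
    ((norm_gram_sub_conjTranspose W M).trans_le hE) ((norm_inv_conjTranspose M).trans_le hτ)
  rwa [← Matrix.l2_opNorm_conjTranspose, Matrix.conjTranspose_mul,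
    Matrix.conjTranspose_nonsing_inv, Matrix.conjTranspose_conjTranspose] at h

theorem norm_blockReflector_gram_le {W : Matrix ι κ ℂ} {M : Matrix κ κ ℂ} {δ η : ℝ}
    (hM : IsUnit M) (hE : ‖Wᴴ * W - M - Mᴴ‖ ≤ δ) (hη : ‖M⁻¹ * Wᴴ‖ ≤ η) :
    ‖(blockReflector W M)ᴴ * blockReflector W M - 1‖ ≤ δ * η ^ 2 := by
  have hdet := (Matrix.isUnit_iff_isUnit_det M).1 hM
  set Y := M⁻¹ * Wᴴ with hY
  have h1 : M * Y = Wᴴ := by rw [hY, ← Matrix.mul_assoc, Matrix.mul_nonsing_inv M hdet,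
    Matrix.one_mul]
  have h2 : Yᴴ * (Mᴴ * Y) = W * Y := by
    rw [← Matrix.mul_assoc, ← Matrix.conjTranspose_mul, h1, Matrix.conjTranspose_conjTranspose]
  have h3 : (blockReflector W M)ᴴ * blockReflector W M - 1
      = Yᴴ * ((Wᴴ * W - M - Mᴴ) * Y) := by
    simp only [blockReflector, ← hY, Matrix.conjTranspose_sub, Matrix.conjTranspose_one,
      Matrix.conjTranspose_mul, Matrix.mul_sub, Matrix.sub_mul, Matrix.mul_assoc, h1, h2,
      Matrix.mul_one, Matrix.one_mul]
    abel
  rw [h3]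
  calc _ ≤ η * (δ * η) := specNorm_mul_le_of_le (norm_conjTranspose_le hη) (specNorm_mul_le_of_le hE hη)
    _ = δ * η ^ 2 := by ring

/-- A perturbation that is small relative to `M⁻¹` keeps `M` nonsingular and at most doubles the
norm of the inverse. -/
theorem isUnit_and_norm_inv_le_of_norm_sub_le {M M' : Matrix κ κ ℂ} {d : ℝ} (hM : IsUnit M)
    (hd : ‖M' - M‖ ≤ d) (hsmall : d * ‖M⁻¹‖ ≤ 1 / 2) :
    IsUnit M' ∧ ‖M'⁻¹‖ ≤ 2 * ‖M⁻¹‖ := by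
  have hdet := (Matrix.isUnit_iff_isUnit_det M).1 hM
  have h1 : M * M⁻¹ = 1 := Matrix.mul_nonsing_inv M hdet
  have h2 : M⁻¹ * M = 1 := Matrix.nonsing_inv_mul M hdet
  have h3 : ‖M⁻¹ * (M' - M)‖ ≤ 1 / 2 :=
    (specNorm_mul_le_of_le le_rfl hd).trans (by rwa [mul_comm])
  have h4 : M' = M * (1 - -(M⁻¹ * (M' - M))) := by
    rw [sub_neg_eq_add, mul_add, mul_one, ← mul_assoc, h1, one_mul, add_sub_cancel]
  have hM' : IsUnit M' := by
    rw [h4]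
    exact hM.mul (isUnit_one_sub_of_norm_lt_one (by rw [norm_neg]; linarith))
  refine ⟨hM', ?_⟩
  have h5 : M' * M'⁻¹ = 1 := Matrix.mul_nonsing_inv M' ((Matrix.isUnit_iff_isUnit_det M').1 hM')
  -- The last term has norm at most half of ‖M'⁻¹‖ and is absorbed on the left.
  have h6 : M'⁻¹ = M⁻¹ - M⁻¹ * (M' - M) * M'⁻¹ := by
    rw [mul_assoc, sub_mul, h5, mul_sub, mul_one, ← mul_assoc, h2, one_mul, sub_sub_cancel]
  have h7 : ‖M'⁻¹‖ ≤ ‖M⁻¹‖ + 1 / 2 * ‖M'⁻¹‖ := by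
    conv_lhs => rw [h6]
    exact (norm_sub_le _ _).trans (add_le_add le_rfl (specNorm_mul_le_of_le h3 le_rfl))
  linarith

theorem norm_perturbed_gram_le {W W' : Matrix ι κ ℂ} {M M' : Matrix κ κ ℂ} {δ d w ω : ℝ}
    (hE : ‖Wᴴ * W - M - Mᴴ‖ ≤ δ) (hW : ‖W‖ ≤ w) (hω : ‖W' - W‖ ≤ ω) (hd : ‖M' - M‖ ≤ d) :
    ‖W'ᴴ * W' - M' - M'ᴴ‖ ≤ δ + 2 * d + 2 * w * ω + ω ^ 2 := by
  have h : W'ᴴ * W' - M' - M'ᴴ = (Wᴴ * W - M - Mᴴ) + Wᴴ * (W' - W) + (W' - W)ᴴ * W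
      + (W' - W)ᴴ * (W' - W) - (M' - M) - (M' - M)ᴴ := by
    simp only [Matrix.conjTranspose_sub, Matrix.mul_sub, Matrix.sub_mul]
    abel
  have h1 := specNorm_mul_le_of_le (norm_conjTranspose_le hW) hω
  have h2 := specNorm_mul_le_of_le (norm_conjTranspose_le hω) hW
  have h3 := specNorm_mul_le_of_le (norm_conjTranspose_le hω) hω
  have h4 := norm_conjTranspose_le hd
  rw [h]
  have t1 := norm_sub_le ((Wᴴ * W - M - Mᴴ) + Wᴴ * (W' - W) + (W' - W)ᴴ * W
      + (W' - W)ᴴ * (W' - W) - (M' - M)) (M' - M)ᴴ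
  have t2 := norm_sub_le ((Wᴴ * W - M - Mᴴ) + Wᴴ * (W' - W) + (W' - W)ᴴ * W
      + (W' - W)ᴴ * (W' - W)) (M' - M)
  have t3 := norm_add_le ((Wᴴ * W - M - Mᴴ) + Wᴴ * (W' - W) + (W' - W)ᴴ * W)
      ((W' - W)ᴴ * (W' - W))
  have t4 := norm_add_le ((Wᴴ * W - M - Mᴴ) + Wᴴ * (W' - W)) ((W' - W)ᴴ * W)
  have t5 := norm_add_le (Wᴴ * W - M - Mᴴ) (Wᴴ * (W' - W))
  nlinarith

/-- The difference is split so that inverses occur only inside W' M'⁻¹ and M⁻¹ Wᴴ, each bounded by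
η. -/
theorem norm_blockReflector_sub_le {W W' : Matrix ι κ ℂ} {M M' : Matrix κ κ ℂ} {d ω η : ℝ}
    (hM : IsUnit M) (hM' : IsUnit M') (hω : ‖W' - W‖ ≤ ω) (hd : ‖M' - M‖ ≤ d)
    (hη : ‖M⁻¹ * Wᴴ‖ ≤ η) (hη' : ‖W' * M'⁻¹‖ ≤ η) :
    ‖blockReflector W' M' - blockReflector W M‖ ≤ d * η ^ 2 + 2 * ω * η := by
  have h1 : M * M⁻¹ = 1 := Matrix.mul_nonsing_inv M ((Matrix.isUnit_iff_isUnit_det M).1 hM)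
  have h2 : M'⁻¹ * M' = 1 := Matrix.nonsing_inv_mul M' ((Matrix.isUnit_iff_isUnit_det M').1 hM')
  have h1' : ∀ X : Matrix κ ι ℂ, M * (M⁻¹ * X) = X := fun X => by
    rw [← Matrix.mul_assoc, h1, Matrix.one_mul]
  have h2' : ∀ X : Matrix κ ι ℂ, M'⁻¹ * (M' * X) = X := fun X => by
    rw [← Matrix.mul_assoc, h2, Matrix.one_mul]
  have h : blockReflector W' M' - blockReflector W M
      = W' * M'⁻¹ * ((M' - M) * (M⁻¹ * Wᴴ)) - (W' - W) * (M⁻¹ * Wᴴ)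
        - W' * M'⁻¹ * (W' - W)ᴴ := by
    simp only [blockReflector, Matrix.conjTranspose_sub, Matrix.mul_sub, Matrix.sub_mul,
      Matrix.mul_assoc, h1', h2']
    abel
  rw [h]
  have t1 := norm_sub_le (W' * M'⁻¹ * ((M' - M) * (M⁻¹ * Wᴴ)) - (W' - W) * (M⁻¹ * Wᴴ))
    (W' * M'⁻¹ * (W' - W)ᴴ)
  have t2 := norm_sub_le (W' * M'⁻¹ * ((M' - M) * (M⁻¹ * Wᴴ))) ((W' - W) * (M⁻¹ * Wᴴ))
  have t3 := specNorm_mul_le_of_le hη' (specNorm_mul_le_of_le hd hη)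
  have t4 := specNorm_mul_le_of_le hω hη
  have t5 := specNorm_mul_le_of_le hη' (norm_conjTranspose_le hω)
  nlinarith

end Reflector

/-! ### Backward error of one computed column. -/

section ComputedReflector

variable {ι κ μ : Type*} [Fintype ι] [Fintype κ] [Fintype μ]
  [DecidableEq ι] [DecidableEq κ] [DecidableEq μ]

/-- Backward error of one column of a computed application of a block reflector: up to a final
relative rounding error, the column is `b - W' y` with `(M + N) y = (W' + F)ᴴ b`. -/
theorem IsFlApply.exists_backward {u εsv : ℝ} (hu0 : 0 ≤ u) (hu1 : u < 1)
    {W What : Matrix ι κ ℂ} {M : Matrix κ κ ℂ} {B Z : Matrix ι μ ℂ}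
    (hW : ∀ i l, IsRounded u (W i l) (What i l)) (h : IsFlApply u εsv What M B Z) (j : μ) :
    ∃ (W' F : Matrix ι κ ℂ) (N : Matrix κ κ ℂ) (y : Matrix κ Unit ℂ),
      (∀ i l, ‖(W' - W) i l‖ ≤ gammaFl u (Fintype.card κ + 1) * ‖W i l‖) ∧
      (∀ i l, ‖F i l‖ ≤ gammaFl u (Fintype.card ι + Fintype.card κ + 1) * ‖W i l‖) ∧
      (∀ a b, ‖N a b‖ ≤ εsv * ‖M a b‖) ∧
      (M + N) * y = (W' + F)ᴴ * colMat B j ∧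
      ‖colMat Z j - (colMat B j - W' * y)‖ ≤ u * ‖colMat B j - W' * y‖ := by
  obtain ⟨C, D, E, hC, hD, hE, hZ⟩ := h
  obtain ⟨Θ, hΘ, hCj⟩ := hC.exists_backward hu0 hu1 j
  obtain ⟨Φ, hΦ, hEj⟩ := hE.exists_backward hu0 hu1 j
  obtain ⟨N, hN, hDj⟩ := hD.exists_backward j
  choose ε hε hWhat using hW
  have hstar : ∀ i l, ‖(starRingEnd ℂ) (Θ l i)‖ ≤ gammaFl u (Fintype.card ι) := fun i l => by
    rw [RCLike.norm_conj]; exact hΘ l i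
  -- W' absorbs the rounding of W and of the product W D. The product Wᴴ B has different errors Θ,
  -- and F is the resulting mismatch.
  refine ⟨Matrix.of fun i l => What i l * (1 + Φ i l),
    Matrix.of fun i l => What i l * ((starRingEnd ℂ) (Θ l i) - Φ i l), N, colMat D j,
    fun i l => ?_, fun i l => ?_, hN, ?_, ?_⟩
  · have h1 : (Matrix.of (fun i l => What i l * (1 + Φ i l)) - W) i l
        = W i l * ((1 + Φ i l) * (1 + ε i l) - 1) := by
      simp only [Matrix.sub_apply, Matrix.of_apply, hWhat]
      ring
    rw [h1, norm_mul, mul_comm]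
    gcongr
    exact (norm_one_add_mul_one_add_sub_one_le (hΦ i l)
      ((hε i l).trans (le_gammaFl_one hu0 hu1))).trans_eq (gammaFl_add u _ 1).symm
  · simp only [Matrix.of_apply, hWhat, norm_mul]
    have h1 : ‖1 + ε i l‖ ≤ 1 + u :=
      (norm_add_le _ _).trans (by rw [norm_one]; exact add_le_add le_rfl (hε i l))
    have h2 : ‖(starRingEnd ℂ) (Θ l i) - Φ i l‖
        ≤ gammaFl u (Fintype.card ι + Fintype.card κ) :=
      (norm_sub_le _ _).trans ((add_le_add (hstar i l) (hΦ i l)).trans (gammaFl_add_le hu0 hu1 _ _))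
    have h3 := add_gammaFl_le hu0 hu1 (Fintype.card ι + Fintype.card κ)
    calc ‖W i l‖ * ‖1 + ε i l‖ * ‖(starRingEnd ℂ) (Θ l i) - Φ i l‖
        ≤ ‖W i l‖ * (1 + u) * gammaFl u (Fintype.card ι + Fintype.card κ) := by gcongr
      _ = (gammaFl u (Fintype.card ι + Fintype.card κ)
          + u * gammaFl u (Fintype.card ι + Fintype.card κ)) * ‖W i l‖ := by ring
      _ ≤ _ := by gcongr; linarith
  · rw [hDj, hCj]
    congr 1
    ext l i
    simp only [Matrix.conjTranspose_apply, Matrix.add_apply, Matrix.of_apply]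
    rw [← mul_add]
    simp
  · rw [← hEj]
    refine norm_col_le_of_forall_norm_le hu0 fun i a => ?_
    obtain ⟨d, hd, hz⟩ := hZ i j
    have h1 : (colMat Z j - (colMat B j - colMat E j)) i a = (B i j - E i j) * d := by
      simp only [colMat, Matrix.sub_apply, Matrix.submatrix_apply, id, hz]
      ring
    rw [h1, norm_mul, mul_comm]
    exact mul_le_mul_of_nonneg_right hd (norm_nonneg _)

/-- A computed column is close to the exact application of the perturbed reflector. -/
theorem norm_sub_blockReflector_mul_le {W' F : Matrix ι κ ℂ} {M' : Matrix κ κ ℂ}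
    {b z : Matrix ι Unit ℂ} {y : Matrix κ Unit ℂ} {u φ η h : ℝ} (hu0 : 0 ≤ u)
    (hM' : IsUnit M') (hη : ‖W' * M'⁻¹‖ ≤ η) (hF : ‖F‖ ≤ φ) (hh : ‖blockReflector W' M'‖ ≤ h)
    (hy : M' * y = (W' + F)ᴴ * b) (hz : ‖z - (b - W' * y)‖ ≤ u * ‖b - W' * y‖) :
    ‖z - blockReflector W' M' * b‖ ≤ ((1 + u) * φ * η + u * h) * ‖b‖ := by
  have h2 : M'⁻¹ * M' = 1 := Matrix.nonsing_inv_mul M' ((Matrix.isUnit_iff_isUnit_det M').1 hM')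
  have hy' : y = M'⁻¹ * ((W' + F)ᴴ * b) := by
    rw [← hy, ← Matrix.mul_assoc, h2, Matrix.one_mul]
  have hr : b - W' * y = blockReflector W' M' * b - W' * M'⁻¹ * (Fᴴ * b) := by
    rw [hy']
    simp only [blockReflector, Matrix.conjTranspose_add, Matrix.mul_add, Matrix.add_mul,
      Matrix.sub_mul, Matrix.mul_assoc, Matrix.one_mul]
    abel
  have t1 := specNorm_mul_le_of_le hη
    (specNorm_mul_le_of_le (norm_conjTranspose_le hF) (le_refl ‖b‖))
  have t2 := specNorm_mul_le_of_le hh (le_refl ‖b‖)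
  have t3 : ‖b - W' * y‖ ≤ h * ‖b‖ + η * (φ * ‖b‖) := by
    rw [hr]
    exact (norm_sub_le _ _).trans (add_le_add t2 t1)
  have h3 : z - blockReflector W' M' * b = (z - (b - W' * y)) - W' * M'⁻¹ * (Fᴴ * b) := by
    rw [hr]; abel
  rw [h3]
  have t4 := norm_sub_le (z - (b - W' * y)) (W' * M'⁻¹ * (Fᴴ * b))
  have t5 := mul_le_mul_of_nonneg_left t3 hu0
  nlinarith

/-- `Vᴴ` almost annihilates the columns of the perturbed reflector below the leading block. -/
theorem norm_conjTranspose_mul_blockReflector_mul_le {V W W' : Matrix ι κ ℂ}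
    {X : Matrix ι κ ℂ} {M M' : Matrix κ κ ℂ} {b : Matrix ι Unit ℂ} {δ d v ω η : ℝ}
    (hM' : IsUnit M') (hV : V = X - W) (hX : Wᴴ * X = M) (hb : Xᴴ * b = 0)
    (hE : ‖Wᴴ * W - M - Mᴴ‖ ≤ δ) (hv : ‖V‖ ≤ v) (hω : ‖W' - W‖ ≤ ω) (hd : ‖M' - M‖ ≤ d)
    (hη : ‖M'⁻¹ * W'ᴴ‖ ≤ η) :
    ‖Vᴴ * (blockReflector W' M' * b)‖ ≤ ((δ + d + v * ω) * η + ω) * ‖b‖ := by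
  have h1 : ∀ x : Matrix κ Unit ℂ, M' * (M'⁻¹ * x) = x := fun x => by
    rw [← Matrix.mul_assoc, Matrix.mul_nonsing_inv M' ((Matrix.isUnit_iff_isUnit_det M').1 hM'),
      Matrix.one_mul]
  have hX' : ∀ x : Matrix κ Unit ℂ, Xᴴ * (W * x) = Mᴴ * x := fun x => by
    rw [← hX, Matrix.conjTranspose_mul, Matrix.conjTranspose_conjTranspose, Matrix.mul_assoc]
  -- Because Xᴴ b = 0 and Xᴴ W = Mᴴ, the zeroth-order terms combine into the defect; the rest is
  -- linear in W' - W and M' - M.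
  have h : Vᴴ * (blockReflector W' M' * b)
      = ((Wᴴ * W - M - Mᴴ) - (M' - M) - Vᴴ * (W' - W)) * (M'⁻¹ * W'ᴴ * b) + (W' - W)ᴴ * b := by
    rw [hV]
    simp only [blockReflector, Matrix.conjTranspose_sub, Matrix.mul_sub,
      Matrix.sub_mul, Matrix.mul_assoc, h1, hX', hb, Matrix.one_mul]
    abel
  rw [h]
  have t0 : ‖(Wᴴ * W - M - Mᴴ) - (M' - M) - Vᴴ * (W' - W)‖ ≤ δ + d + v * ω :=
    (norm_sub_le _ _).trans (add_le_add ((norm_sub_le _ _).trans (add_le_add hE hd))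
      (specNorm_mul_le_of_le (norm_conjTranspose_le hv) hω))
  have t1 := specNorm_mul_le_of_le t0 (specNorm_mul_le_of_le hη (le_refl ‖b‖))
  have t2 := specNorm_mul_le_of_le (norm_conjTranspose_le hω) (le_refl ‖b‖)
  calc _ ≤ (δ + d + v * ω) * (η * ‖b‖) + ω * ‖b‖ := (norm_add_le _ _).trans (add_le_add t1 t2)
    _ = _ := by ring

end ComputedReflector

/-! ### Uniform constants for all columns. -/

section ComputedColumns

variable {ι κ μ : Type*} [Fintype ι] [Fintype κ] [Fintype μ]
  [DecidableEq ι] [DecidableEq κ] [DecidableEq μ]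

theorem norm_blockReflector_le {W : Matrix ι κ ℂ} {M : Matrix κ κ ℂ}
    {δ η : ℝ} (hM : IsUnit M) (hE : ‖Wᴴ * W - M - Mᴴ‖ ≤ δ)
    (hη : ‖M⁻¹ * Wᴴ‖ ≤ η) : ‖blockReflector W M‖ ≤ √(1 + δ * η ^ 2) :=
  norm_le_of_gram (norm_blockReflector_gram_le hM hE hη)

theorem norm_sub_le_of_solve {M Mhat N : Matrix κ κ ℂ} {εT εsv : ℝ} (hεsv : 0 ≤ εsv)
    (hM3 : ‖M‖ ≤ 3) (hεT : ‖Mhat - M‖ ≤ εT) (hN : ∀ a b, ‖N a b‖ ≤ εsv * ‖Mhat a b‖) :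
    ‖Mhat + N - M‖ ≤ εT + 3 * √(Fintype.card κ) * εsv * (1 + εT) := by
  have h0 : 0 ≤ εT := (norm_nonneg _).trans hεT
  have h1 : ‖Mhat‖ ≤ 3 + εT := by
    calc ‖Mhat‖ = ‖M + (Mhat - M)‖ := by rw [add_sub_cancel]
      _ ≤ 3 + εT := (norm_add_le _ _).trans (add_le_add hM3 hεT)
  have h2 : ‖N‖ ≤ εsv * (√(Fintype.card κ) * (3 * (1 + εT))) := by
    refine (norm_le_of_forall_norm_le hεsv hN).trans ?_
    gcongr
    linarith
  calc ‖Mhat + N - M‖ = ‖(Mhat - M) + N‖ := by rw [sub_add_eq_add_sub]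
    _ ≤ εT + εsv * (√(Fintype.card κ) * (3 * (1 + εT))) :=
        (norm_add_le _ _).trans (add_le_add hεT h2)
    _ = _ := by ring

theorem IsFlApply.exists_blockReflector {u εsv εT δT δ γ ε₁ η ε₂ ε₃ : ℝ}
    (hu0 : 0 ≤ u) (hu1 : u < 1) (hεsv : 0 ≤ εsv)
    {W What : Matrix ι κ ℂ} {M Mhat : Matrix κ κ ℂ} {B Z : Matrix ι μ ℂ}
    (hWhat : ∀ i l, IsRounded u (W i l) (What i l)) (h : IsFlApply u εsv What Mhat B Z)
    (hM : IsUnit M) (hM3 : ‖M‖ ≤ 3) (hW : ‖W‖ ≤ 2 * √2) (hMhat : ‖Mhat - M‖ ≤ εT)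
    (hE : ‖Wᴴ * W - M - Mᴴ‖ ≤ δ)
    (hγ : γ = gammaFl u (Fintype.card κ + 1))
    (hδT : δT = εT + 3 * √(Fintype.card κ) * εsv * (1 + εT))
    (hε₁ : ε₁ = δ + 2 * δT + 16 * √(Fintype.card κ) * γ + 8 * (Fintype.card κ : ℝ) * γ ^ 2)
    (hη : η = 2 * √(‖M⁻¹‖ ^ 2 * ε₁ + ‖M⁻¹‖))
    (hε₂ : ε₂ = (δT + 8 * (Fintype.card κ : ℝ) * γ ^ 2) * η ^ 2
      + 4 * √(2 * (Fintype.card κ : ℝ)) * γ * η)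
    (hε₃ : ε₃ = 2 * √(2 * (Fintype.card κ : ℝ))
      * gammaFl u (Fintype.card ι + 2 * Fintype.card κ + 1) * η + u * (√(1 + δ * η ^ 2) + ε₂))
    (hsmall : δT * ‖M⁻¹‖ ≤ 1 / 2) :
    ‖M⁻¹ * Wᴴ‖ ≤ η ∧ ∀ j, ∃ (W' : Matrix ι κ ℂ) (M' : Matrix κ κ ℂ),
      IsUnit M' ∧ ‖M'⁻¹ * W'ᴴ‖ ≤ η ∧ ‖M' - M‖ ≤ δT ∧
      ‖W' - W‖ ≤ 2 * √(2 * (Fintype.card κ : ℝ)) * γ ∧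
      ‖blockReflector W' M' - blockReflector W M‖ ≤ ε₂ ∧
      ‖colMat Z j - blockReflector W' M' * colMat B j‖ ≤ ε₃ * ‖colMat B j‖ := by
  have hγ0 : 0 ≤ γ := hγ ▸ gammaFl_nonneg hu0 hu1 _
  have hδ0 : 0 ≤ δ := (norm_nonneg _).trans hE
  have hεT0 : 0 ≤ εT := (norm_nonneg _).trans hMhat
  have hδT0 : 0 ≤ δT := by rw [hδT]; positivity
  have hε₁0 : 0 ≤ ε₁ := by rw [hε₁]; positivity
  have hη0 : 0 ≤ η := by rw [hη]; positivity
  -- This is the bound of `norm_mul_inv_sq_le` with ‖M⁻¹‖ doubled, which explains the factor 2 in η.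
  have hη2 : η ^ 2 = (2 * ‖M⁻¹‖) ^ 2 * ε₁ + 2 * (2 * ‖M⁻¹‖) := by
    rw [hη, mul_pow, Real.sq_sqrt (by positivity)]; ring
  have hδε : δ ≤ ε₁ := by
    rw [hε₁]
    have : 0 ≤ 2 * δT + 16 * √(Fintype.card κ) * γ + 8 * (Fintype.card κ : ℝ) * γ ^ 2 := by
      positivity
    linarith
  have hY : ‖M⁻¹ * Wᴴ‖ ≤ η := by
    refine le_of_pow_le_pow_left₀ two_ne_zero hη0 ?_
    refine (norm_inv_mul_conjTranspose_sq_le hM hE le_rfl).trans ?_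
    rw [hη2]
    nlinarith [norm_nonneg M⁻¹, sq_nonneg ‖M⁻¹‖, mul_le_mul_of_nonneg_left hδε (sq_nonneg ‖M⁻¹‖),
      mul_nonneg (sq_nonneg ‖M⁻¹‖) hε₁0]
  refine ⟨hY, fun j => ?_⟩
  obtain ⟨W', F, N, y, hW', hF, hN, hy, hz⟩ := h.exists_backward hu0 hu1 hWhat j
  have hs2 : √(2 * (Fintype.card κ : ℝ)) = √2 * √(Fintype.card κ : ℝ) :=
    Real.sqrt_mul zero_le_two _
  have hs2' : √2 ^ 2 = (2 : ℝ) := Real.sq_sqrt zero_le_two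
  have hsk : √(Fintype.card κ : ℝ) ^ 2 = Fintype.card κ := Real.sq_sqrt (Nat.cast_nonneg _)
  have hω : ‖W' - W‖ ≤ 2 * √(2 * (Fintype.card κ : ℝ)) * γ := by
    rw [← hγ] at hW'
    refine (norm_le_of_forall_norm_le hγ0 hW').trans ?_
    calc γ * (√(Fintype.card κ) * ‖W‖) ≤ γ * (√(Fintype.card κ) * (2 * √2)) := by gcongr
      _ = _ := by rw [hs2]; ring
  have hd : ‖Mhat + N - M‖ ≤ δT := hδT ▸ norm_sub_le_of_solve hεsv hM3 hMhat hN
  obtain ⟨hM', hinv⟩ := isUnit_and_norm_inv_le_of_norm_sub_le hM hd hsmall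
  have hE' : ‖W'ᴴ * W' - (Mhat + N) - (Mhat + N)ᴴ‖ ≤ ε₁ := by
    -- With w = 2√2 and ω = 2√(2k₀)γ, 2wω = 16√k₀ γ and ω² = 8k₀γ².
    refine (norm_perturbed_gram_le hE hW hω hd).trans_eq ?_
    rw [hε₁, hs2]
    linear_combination (8 * √(Fintype.card κ : ℝ) * γ + 4 * γ ^ 2 * √(Fintype.card κ : ℝ) ^ 2) * hs2'
      + 8 * γ ^ 2 * hsk
  have hη' : ‖W' * (Mhat + N)⁻¹‖ ≤ η :=
    le_of_pow_le_pow_left₀ two_ne_zero hη0 ((norm_mul_inv_sq_le hM' hE' hinv).trans_eq hη2.symm)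
  have hY' : ‖(Mhat + N)⁻¹ * W'ᴴ‖ ≤ η :=
    le_of_pow_le_pow_left₀ two_ne_zero hη0
      ((norm_inv_mul_conjTranspose_sq_le hM' hE' hinv).trans_eq hη2.symm)
  have hH : ‖blockReflector W' (Mhat + N) - blockReflector W M‖ ≤ ε₂ := by
    refine (norm_blockReflector_sub_le hM hM' hω hd hY hη').trans ?_
    rw [hε₂]
    have : 0 ≤ 8 * (Fintype.card κ : ℝ) * γ ^ 2 * η ^ 2 := by positivity
    linarith
  refine ⟨W', Mhat + N, hM', hY', hd, hω, hH, ?_⟩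
  have hh : ‖blockReflector W' (Mhat + N)‖ ≤ √(1 + δ * η ^ 2) + ε₂ := by
    calc _ = ‖blockReflector W M + (blockReflector W' (Mhat + N) - blockReflector W M)‖ := by
          rw [add_sub_cancel]
      _ ≤ _ := (norm_add_le _ _).trans
          (add_le_add (norm_blockReflector_le hM hE hY) hH)
  set g := gammaFl u (Fintype.card ι + Fintype.card κ + 1) with hg
  have hg0 : 0 ≤ g := gammaFl_nonneg hu0 hu1 _
  have hF' : ‖F‖ ≤ g * (√(Fintype.card κ) * (2 * √2)) :=
    (norm_le_of_forall_norm_le hg0 hF).trans (by gcongr)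
  refine (norm_sub_blockReflector_mul_le hu0 hM' hη' hF' hh hy hz).trans ?_
  refine mul_le_mul_of_nonneg_right ?_ (norm_nonneg _)
  rw [hε₃, hs2]
  -- The factor 1 + u costs one index, which fits below n + 2k₀ + 1 only if k₀ ≥ 1; for k₀ = 0 the
  -- factor √k₀ vanishes.
  have hfinal : (1 + u) * g * √(Fintype.card κ)
      ≤ gammaFl u (Fintype.card ι + 2 * Fintype.card κ + 1) * √(Fintype.card κ) := by
    rcases Nat.eq_zero_or_pos (Fintype.card κ) with h0 | h0
    · simp [h0]
    · refine mul_le_mul_of_nonneg_right ?_ (Real.sqrt_nonneg _)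
      have := add_gammaFl_le hu0 hu1 (Fintype.card ι + Fintype.card κ + 1)
      refine le_trans ?_ (this.trans (gammaFl_mono hu0 hu1 (by omega)))
      rw [← hg]
      linarith
  have := mul_le_mul_of_nonneg_right hfinal (mul_nonneg (mul_nonneg zero_le_two
    (Real.sqrt_nonneg 2)) hη0)
  linarith

end ComputedColumns

/-! ### From columns to orthogonality and residual. -/

section Factors

variable {ι κ μ ν : Type*} [Fintype ι] [Fintype κ] [Fintype μ] [Fintype ν]
  [DecidableEq ι] [DecidableEq κ] [DecidableEq μ] [DecidableEq ν]

/-- Loss of orthogonality when a nearly unitary matrix is applied, inexactly, to a matrix with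
nearly orthonormal columns. -/
theorem norm_gram_sub_one_le_of_perturbed {H : Matrix ι ι ℂ} {Q₀ Q : Matrix ι μ ℂ} {e t s : ℝ}
    (he : ‖Q₀ᴴ * Q₀ - 1‖ ≤ e) (he1 : e ≤ 1 / 3) (ht : ‖Hᴴ * H - 1‖ ≤ t)
    (hs0 : 0 ≤ s) (hs : ‖Q - H * Q₀‖ ≤ s * ‖Q₀‖) :
    ‖Qᴴ * Q - 1‖ ≤ e + 2 * (t + 2 * √(1 + t) * s + s ^ 2) := by
  have hh := norm_le_of_gram ht
  have hq := norm_sq_le_of_gram he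
  have ht0 : 0 ≤ t := (norm_nonneg _).trans ht
  have h : Qᴴ * Q - 1 = (Q₀ᴴ * Q₀ - 1) + Q₀ᴴ * ((Hᴴ * H - 1) * Q₀)
      + (H * Q₀)ᴴ * (Q - H * Q₀) + (Q - H * Q₀)ᴴ * (H * Q₀)
      + (Q - H * Q₀)ᴴ * (Q - H * Q₀) := by
    simp only [Matrix.conjTranspose_sub, Matrix.conjTranspose_mul, Matrix.mul_sub, Matrix.sub_mul,
      Matrix.mul_assoc, Matrix.one_mul]
    abel
  have t1 := specNorm_mul_le_of_le (norm_conjTranspose_le (le_refl ‖Q₀‖))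
    (specNorm_mul_le_of_le ht (le_refl ‖Q₀‖))
  have hHQ := specNorm_mul_le_of_le hh (le_refl ‖Q₀‖)
  have t2 := specNorm_mul_le_of_le (norm_conjTranspose_le hHQ) hs
  have t3 := specNorm_mul_le_of_le (norm_conjTranspose_le hs) hHQ
  have t4 := specNorm_mul_le_of_le (norm_conjTranspose_le hs) hs
  have key : ‖Qᴴ * Q - 1‖ ≤ e + ‖Q₀‖ * (t * ‖Q₀‖) + √(1 + t) * ‖Q₀‖ * (s * ‖Q₀‖)
      + s * ‖Q₀‖ * (√(1 + t) * ‖Q₀‖) + s * ‖Q₀‖ * (s * ‖Q₀‖) := by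
    rw [h]
    exact (norm_add_le _ _).trans (add_le_add ((norm_add_le _ _).trans (add_le_add
      ((norm_add_le _ _).trans (add_le_add ((norm_add_le _ _).trans (add_le_add he t1)) t2)) t3))
      t4)
  have hx : 0 ≤ t + 2 * √(1 + t) * s + s ^ 2 := by positivity
  -- From ‖Q₀‖² ≤ 1 + e ≤ 4/3; hence the factor 2 in the bound.
  have hq2 : ‖Q₀‖ ^ 2 ≤ 2 := by linarith
  have := mul_le_mul_of_nonneg_right hq2 hx
  linarith

theorem residual_bound_arith {t h s r d g L : ℝ} (h1 : 1 ≤ h) (hs : 0 ≤ s) (hr0 : 0 ≤ r)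
    (hr1 : r ≤ 1) (hd : 0 ≤ d) (hg : 0 ≤ g) (hL : L = h + s) :
    t + h * s + h * r * L + s * (√2 * ((1 + r) * L)) + h * d * L + g * L
      ≤ t + L ^ 2 * (r + d + 3 * s + g) := by
  have hs2 : √2 ≤ 3 / 2 := Real.sqrt_le_iff.2 ⟨by norm_num, by norm_num⟩
  have hL1 : 1 ≤ L := by linarith
  have hhL : h ≤ L := by linarith
  have hLL : L ≤ L ^ 2 := by nlinarith
  -- Here r ≤ 1 is essential. The 2 yields two of the three s in 3s (the third is h * s), and the r
  -- completes h * r * L to r * L².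
  have hc : √2 * (1 + r) ≤ 2 + r := by nlinarith
  have a1 : h * s ≤ s * L ^ 2 := by nlinarith
  have a2 : s * (√2 * ((1 + r) * L)) ≤ 2 * s * L ^ 2 + r * s * L := by
    have b1 := mul_le_mul_of_nonneg_right hc (mul_nonneg hs (by linarith : (0 : ℝ) ≤ L))
    have b2 := mul_le_mul_of_nonneg_left hLL hs
    linarith
  have a3 : h * r * L + r * s * L = L ^ 2 * r := by rw [hL]; ring
  have a4 : h * d * L ≤ L ^ 2 * d := by
    have := mul_le_mul_of_nonneg_right hhL (mul_nonneg hd (by linarith : (0 : ℝ) ≤ L))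
    linarith
  have a5 := mul_le_mul_of_nonneg_left hLL hg
  linarith

/-- The squared norms are at most 4/3 and (3/2) c², with product 2c². This turns an error relative
to ‖Qs‖, multiplied by R, into one relative to ‖A‖. -/
theorem norm_mul_norm_le_of_nearly_isometry {X : Matrix ι κ ℂ} {R : Matrix κ μ ℂ} {e c : ℝ}
    (he : ‖Xᴴ * X - 1‖ ≤ e) (he1 : e ≤ 1 / 3) (hc : ‖X * R‖ ≤ c) : ‖X‖ * ‖R‖ ≤ √2 * c := by
  have hc0 : 0 ≤ c := (norm_nonneg _).trans hc
  refine le_of_pow_le_pow_left₀ two_ne_zero (by positivity) ?_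
  have h1 := norm_sq_le_of_gram he
  have h2 := norm_sq_le_norm_mul_sq he R
  have h3 : ‖X * R‖ ^ 2 ≤ c ^ 2 := pow_le_pow_left₀ (norm_nonneg _) hc 2
  rw [mul_pow, mul_pow, Real.sq_sqrt zero_le_two]
  have h4 : ‖X‖ ^ 2 ≤ 4 / 3 := by linarith
  have h5 : ‖R‖ ^ 2 * (2 / 3) ≤ c ^ 2 := by nlinarith [sq_nonneg ‖R‖]
  nlinarith [mul_le_mul_of_nonneg_right h4 (sq_nonneg ‖R‖)]

/-- The exact reflector maps the leading block to `V`. -/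
theorem blockReflector_mul_eq {V W X : Matrix ι κ ℂ} {M : Matrix κ κ ℂ} (hM : IsUnit M)
    (hV : V = X - W) (hX : Wᴴ * X = M) : blockReflector W M * X = V := by
  rw [blockReflector, Matrix.sub_mul, Matrix.one_mul, Matrix.mul_assoc, Matrix.mul_assoc, hX,
    Matrix.nonsing_inv_mul M ((Matrix.isUnit_iff_isUnit_det M).1 hM), Matrix.mul_one, hV]

/-- A is close to H Hᴴ A, hence to H A'. The top rows of A' contribute H E₁ P Pᴴ E₁ᴴ A' ≈ V S up to
P Pᴴ ≈ I, the bottom rows H E₂ Qs R ≈ Q R; each approximation leaves one error term. -/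
theorem norm_two_stage_residual_le {H : Matrix ι ι ℂ} {E₁ V : Matrix ι κ ℂ} {E₂ : Matrix ι ν ℂ}
    {P : Matrix κ κ ℂ} {A A' Q : Matrix ι μ ℂ} {S : Matrix κ μ ℂ} {Qs : Matrix ν μ ℂ}
    {R : Matrix μ μ ℂ} {t s r d g e : ℝ}
    (hE₁ : E₁ᴴ * E₁ = 1) (hE₂ : E₂ᴴ * E₂ = 1) (hE : E₁ * E₁ᴴ + E₂ * E₂ᴴ = 1)
    (hV : H * (E₁ * P) = V)
    (ht : ‖Hᴴ * H - 1‖ ≤ t) (ht' : ‖H * Hᴴ - 1‖ ≤ t) (hs0 : 0 ≤ s)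
    (hA' : ‖A' - Hᴴ * A‖ ≤ s * ‖A‖) (hQ : ‖Q - H * (E₂ * Qs)‖ ≤ s * ‖Qs‖)
    (hP : ‖P * Pᴴ - 1‖ ≤ d) (hS : ‖V * (S - Pᴴ * (E₁ᴴ * A'))‖ ≤ g * ‖A'‖) (hg : 0 ≤ g)
    (he : ‖Qsᴴ * Qs - 1‖ ≤ e) (he1 : e ≤ 1 / 3)
    (hr0 : 0 ≤ r) (hr1 : r ≤ 1) (hR : ‖E₂ᴴ * A' - Qs * R‖ ≤ r * ‖E₂ᴴ * A'‖) :
    ‖A - Q * R - V * S‖ ≤ (t + (√(1 + t) + s) ^ 2 * (r + d + 3 * s + g)) * ‖A‖ := by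
  have ht0 : 0 ≤ t := (norm_nonneg _).trans ht
  have hd0 : 0 ≤ d := (norm_nonneg _).trans hP
  have hh := norm_le_of_gram ht
  have hh1 : 1 ≤ √(1 + t) := Real.one_le_sqrt.2 (by linarith)
  set h := √(1 + t) with hh_def
  set L := h + s with hL
  have hsum : H * A' = H * (E₁ * (E₁ᴴ * A')) + H * (E₂ * (E₂ᴴ * A')) := by
    rw [← Matrix.mul_add, ← Matrix.mul_assoc, ← Matrix.mul_assoc, ← Matrix.add_mul, hE,
      Matrix.one_mul]
  have hAL : ‖A'‖ ≤ L * ‖A‖ := by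
    calc ‖A'‖ = ‖Hᴴ * A + (A' - Hᴴ * A)‖ := by rw [add_sub_cancel]
      _ ≤ h * ‖A‖ + s * ‖A‖ := (norm_add_le _ _).trans
          (add_le_add (specNorm_mul_le_of_le (norm_conjTranspose_le hh) le_rfl) hA')
      _ = L * ‖A‖ := by rw [hL]; ring
  have hA1 : ‖E₁ᴴ * A'‖ ≤ L * ‖A‖ := (norm_conjTranspose_isometry_mul_le hE₁ _).trans hAL
  have hA2 : ‖E₂ᴴ * A'‖ ≤ L * ‖A‖ := (norm_conjTranspose_isometry_mul_le hE₂ _).trans hAL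
  have hρ : ‖E₂ᴴ * A' - Qs * R‖ ≤ r * (L * ‖A‖) := hR.trans (by gcongr)
  have hQR : ‖Qs * R‖ ≤ (1 + r) * L * ‖A‖ := by
    calc ‖Qs * R‖ = ‖E₂ᴴ * A' - (E₂ᴴ * A' - Qs * R)‖ := by rw [sub_sub_cancel]
      _ ≤ L * ‖A‖ + r * (L * ‖A‖) := (norm_sub_le _ _).trans (add_le_add hA2 hρ)
      _ = _ := by ring
  have hdecomp : A - Q * R - V * S = H * (E₂ * (E₂ᴴ * A' - Qs * R)) - (H * Hᴴ - 1) * A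
      - H * (A' - Hᴴ * A) - (Q - H * (E₂ * Qs)) * R
      - H * (E₁ * ((P * Pᴴ - 1) * (E₁ᴴ * A'))) - V * (S - Pᴴ * (E₁ᴴ * A')) := by
    have hVP : V * (Pᴴ * (E₁ᴴ * A')) = H * (E₁ * (P * (Pᴴ * (E₁ᴴ * A')))) := by
      rw [← hV]; simp only [Matrix.mul_assoc]
    simp only [Matrix.mul_sub, Matrix.sub_mul, Matrix.mul_assoc, Matrix.one_mul, hVP, hsum]
    abel
  have t1 : ‖H * (E₂ * (E₂ᴴ * A' - Qs * R))‖ ≤ h * (r * (L * ‖A‖)) :=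
    specNorm_mul_le_of_le hh ((norm_isometry_mul hE₂ _).trans_le hρ)
  have t2 := specNorm_mul_le_of_le ht' (le_refl ‖A‖)
  have t3 := specNorm_mul_le_of_le hh hA'
  have t4 : ‖(Q - H * (E₂ * Qs)) * R‖ ≤ s * (√2 * ((1 + r) * L * ‖A‖)) := by
    refine (specNorm_mul_le_of_le hQ (le_refl ‖R‖)).trans ?_
    rw [mul_assoc]
    exact mul_le_mul_of_nonneg_left (norm_mul_norm_le_of_nearly_isometry he he1 hQR) hs0
  have t5 : ‖H * (E₁ * ((P * Pᴴ - 1) * (E₁ᴴ * A')))‖ ≤ h * (d * (L * ‖A‖)) :=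
    specNorm_mul_le_of_le hh
      ((norm_isometry_mul hE₁ _).trans_le (specNorm_mul_le_of_le hP hA1))
  have t6 : ‖V * (S - Pᴴ * (E₁ᴴ * A'))‖ ≤ g * (L * ‖A‖) := hS.trans (by gcongr)
  have key : ‖A - Q * R - V * S‖ ≤ h * (r * (L * ‖A‖)) + t * ‖A‖ + h * (s * ‖A‖)
      + s * (√2 * ((1 + r) * L * ‖A‖)) + h * (d * (L * ‖A‖)) + g * (L * ‖A‖) := by
    rw [hdecomp]
    exact (norm_sub_le _ _).trans (add_le_add ((norm_sub_le _ _).trans (add_le_add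
      ((norm_sub_le _ _).trans (add_le_add ((norm_sub_le _ _).trans (add_le_add
      ((norm_sub_le _ _).trans (add_le_add t1 t2)) t3)) t4)) t5)) t6)
  have := mul_le_mul_of_nonneg_right
    (residual_bound_arith (t := t) hh1 hs0 hr0 hr1 hd0 hg hL) (norm_nonneg A)
  linarith

/-- Error of a computed product `Z` of `X` and `Y`. -/
theorem IsFlMul.norm_sub_le {u : ℝ} (hu0 : 0 ≤ u) (hu1 : u < 1) {X : Matrix ι κ ℂ}
    {Y : Matrix κ μ ℂ} {Z : Matrix ι μ ℂ} (h : IsFlMul u X Y Z) :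
    ‖Z - X * Y‖ ≤ Fintype.card κ * gammaFl u (Fintype.card κ) * ‖X‖ * ‖Y‖ := by
  set g := gammaFl u (Fintype.card κ) with hg
  have hg0 : 0 ≤ g := gammaFl_nonneg hu0 hu1 _
  have hcol : ∀ j, ‖colMat (Z - X * Y) j‖
      ≤ g * (√(Fintype.card κ) * ‖X‖) * ‖colMat Y j‖ := fun j => by
    obtain ⟨Θ, hΘ, hZ⟩ := h.exists_backward hu0 hu1 j
    have h1 : colMat (Z - X * Y) j = (Matrix.of fun i l => X i l * Θ i l) * colMat Y j := by
      rw [colMat_sub, hZ, colMat_mul, ← Matrix.sub_mul]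
      congr 1
      ext i l
      simp only [Matrix.sub_apply, Matrix.of_apply]
      ring
    rw [h1]
    refine specNorm_mul_le_of_le (norm_le_of_forall_norm_le hg0 fun i l => ?_) le_rfl
    rw [Matrix.of_apply, norm_mul, mul_comm]
    exact mul_le_mul_of_nonneg_right (hΘ i l) (norm_nonneg _)
  -- One √k₀ comes from the entrywise error in X, the other from the Frobenius norm of Y.
  calc ‖Z - X * Y‖ ≤ frobNorm (Z - X * Y) := norm_le_frobNorm _
    _ ≤ g * (√(Fintype.card κ) * ‖X‖) * frobNorm Y :=
        frobNorm_le_of_forall_colMat (by positivity) hcol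
    _ ≤ g * (√(Fintype.card κ) * ‖X‖) * (√(Fintype.card κ) * ‖Y‖) := by
        gcongr; exact frobNorm_le_sqrt_card_mul_norm' Y
    _ = √(Fintype.card κ) ^ 2 * g * ‖X‖ * ‖Y‖ := by ring
    _ = _ := by rw [Real.sq_sqrt (Nat.cast_nonneg _)]

theorem norm_sub_blockReflector_mul_le_of_columns {H : Matrix ι ι ℂ} {B Z : Matrix ι μ ℂ} {a c : ℝ}
    (ha : 0 ≤ a) (hc : 0 ≤ c)
    (h : ∀ j, ∃ H' : Matrix ι ι ℂ, ‖H' - H‖ ≤ a ∧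
      ‖colMat Z j - H' * colMat B j‖ ≤ c * ‖colMat B j‖) :
    ‖Z - H * B‖ ≤ √(Fintype.card μ) * (a + c) * ‖B‖ := by
  refine (norm_le_of_forall_colMat (Y := B) (add_nonneg ha hc) fun j => ?_).trans_eq (by ring)
  obtain ⟨H', h1, h2⟩ := h j
  have h3 : colMat (Z - H * B) j
      = (H' - H) * colMat B j + (colMat Z j - H' * colMat B j) := by
    rw [colMat_sub, colMat_mul, Matrix.sub_mul]
    abel
  rw [h3, add_mul]
  exact (norm_add_le _ _).trans (add_le_add (specNorm_mul_le_of_le h1 le_rfl) h2)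

end Factors

/-! ### Block rows, the kernel defect and the size of η. -/

section TwoStage

theorem specNorm_eq_norm {ι κ : Type*} [Fintype ι] [Fintype κ] [DecidableEq κ]
    (M : Matrix ι κ ℂ) : specNorm M = ‖M‖ := rfl

/-- Embedding of the leading block of rows. -/
def topEmbed (a b : ℕ) : Matrix (Fin a ⊕ Fin b) (Fin a) ℂ := Matrix.fromRows 1 0

/-- Embedding of the trailing block of rows. -/
def botEmbed (a b : ℕ) : Matrix (Fin a ⊕ Fin b) (Fin b) ℂ := Matrix.fromRows 0 1

variable {a b : ℕ} {μ : Type*}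

theorem topEmbed_mul (X : Matrix (Fin a) μ ℂ) : topEmbed a b * X = Matrix.fromRows X 0 := by
  simp [topEmbed, Matrix.fromRows_mul]

theorem botEmbed_mul (X : Matrix (Fin b) μ ℂ) : botEmbed a b * X = Matrix.fromRows 0 X := by
  simp [botEmbed, Matrix.fromRows_mul]

theorem topEmbed_conjTranspose_mul (X : Matrix (Fin a ⊕ Fin b) μ ℂ) :
    (topEmbed a b)ᴴ * X = X.toRows₁ := by
  conv_lhs => rw [← Matrix.fromRows_toRows X]
  rw [topEmbed, Matrix.conjTranspose_fromRows_eq_fromCols_conjTranspose,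
    Matrix.fromCols_mul_fromRows, Matrix.conjTranspose_one, Matrix.conjTranspose_zero,
    Matrix.one_mul, Matrix.zero_mul, add_zero]

theorem botEmbed_conjTranspose_mul (X : Matrix (Fin a ⊕ Fin b) μ ℂ) :
    (botEmbed a b)ᴴ * X = X.toRows₂ := by
  conv_lhs => rw [← Matrix.fromRows_toRows X]
  rw [botEmbed, Matrix.conjTranspose_fromRows_eq_fromCols_conjTranspose,
    Matrix.fromCols_mul_fromRows, Matrix.conjTranspose_one, Matrix.conjTranspose_zero,
    Matrix.one_mul, Matrix.zero_mul, zero_add]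

theorem topEmbed_gram : (topEmbed a b)ᴴ * topEmbed a b = 1 := by
  rw [topEmbed_conjTranspose_mul]; simp [topEmbed]

theorem botEmbed_gram : (botEmbed a b)ᴴ * botEmbed a b = 1 := by
  rw [botEmbed_conjTranspose_mul]; simp [botEmbed]

theorem topEmbed_conjTranspose_mul_botEmbed : (topEmbed a b)ᴴ * botEmbed a b = 0 := by
  rw [topEmbed_conjTranspose_mul]; simp [botEmbed]

theorem topEmbed_add_botEmbed :
    topEmbed a b * (topEmbed a b)ᴴ + botEmbed a b * (botEmbed a b)ᴴ = 1 := by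
  rw [topEmbed_mul, botEmbed_mul]
  ext (i | i) (j | j) <;> simp [topEmbed, botEmbed, Matrix.one_apply, eq_comm]

/-- The cross terms Xᴴ V and Vᴴ X cancel, leaving Vᴴ V - Xᴴ X. -/
theorem norm_gram_sub_kernel_le {ι κ : Type*} [Fintype ι] [Fintype κ] [DecidableEq κ]
    {X V W : Matrix ι κ ℂ} {M : Matrix κ κ ℂ} (hW : W = X - V) (hX : Wᴴ * X = M) :
    ‖Wᴴ * W - M - Mᴴ‖ ≤ ‖Vᴴ * V - 1‖ + ‖Xᴴ * X - 1‖ := by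
  have h : Wᴴ * W - M - Mᴴ = (Vᴴ * V - 1) - (Xᴴ * X - 1) := by
    rw [← hX, hW]
    simp only [Matrix.conjTranspose_sub, Matrix.conjTranspose_mul,
      Matrix.conjTranspose_conjTranspose, Matrix.mul_sub, Matrix.sub_mul]
    abel
  rw [h]
  exact norm_sub_le _ _

/-- `η = O(√κ₂(T))`. -/
theorem two_mul_sqrt_le_of_cond {N τ ε c : ℝ} (hτ : 0 ≤ τ) (hc : 0 < c) (hcN : c ≤ N)
    (h : N * τ * ε ≤ c) : 2 * √(τ ^ 2 * ε + τ) ≤ 2 * √(2 / c) * √(N * τ) := by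
  rw [mul_assoc, ← Real.sqrt_mul (by positivity)]
  gcongr
  have hN : 0 < N := hc.trans_le hcN
  -- Since c ≤ N, c τ ε ≤ N τ ε ≤ c.
  have h1 : τ * ε ≤ 1 := by
    by_contra hlt
    rw [not_le] at hlt
    nlinarith
  have h2 : τ ^ 2 * ε ≤ τ := by nlinarith
  have h3 : 2 / c * (N * τ) = 2 * (N / c) * τ := by ring
  have h4 : 1 ≤ N / c := (one_le_div hc).2 hcN
  rw [h3]
  nlinarith

end TwoStage

/-! ### Assembly of the bounds. -/

theorem mainTheorem1
    -- dimensions: `n = k₀ + m` rows, so `n - k₀ = m`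
    (k₀ m k n : ℕ) (hn : n = k₀ + m)
    -- unit roundoff, and the error bounds as functions of it and of the dimensions
    (u : ℝ) (hu0 : 0 ≤ u) (hu1 : u < 1)
    (εsv εT : ℝ → ℕ → ℝ) (εorth εres : ℝ → ℕ → ℕ → ℝ)
    (hεsv : 0 ≤ εsv u k₀) (hεT : 0 ≤ εT u k₀)
    (hεorth0 : 0 ≤ εorth u m k) (hεorth1 : εorth u m k ≤ 1 / 3)
    (hεres0 : 0 ≤ εres u m k) (hεres1 : εres u m k ≤ 1)
    -- input, chosen matrix `P`, and the computed quantities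
    (V : Matrix (Fin k₀ ⊕ Fin m) (Fin k₀) ℂ) (A : Matrix (Fin k₀ ⊕ Fin m) (Fin k) ℂ)
    (P : Matrix (Fin k₀) (Fin k₀) ℂ)
    (What : Matrix (Fin k₀ ⊕ Fin m) (Fin k₀) ℂ) (That : Matrix (Fin k₀) (Fin k₀) ℂ)
    (A' : Matrix (Fin k₀ ⊕ Fin m) (Fin k) ℂ) (Shat : Matrix (Fin k₀) (Fin k) ℂ)
    (Qs : Matrix (Fin m) (Fin k) ℂ) (Rhat : Matrix (Fin k) (Fin k) ℂ)
    (Qhat : Matrix (Fin k₀ ⊕ Fin m) (Fin k) ℂ)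
    (hrun : IsTwoStageHouseholderRun u (εsv u k₀) (εT u k₀) (εorth u m k) (εres u m k)
      V A P What That A' Shat Qs Rhat Qhat)
    -- the exact matrix `T`
    (T : Matrix (Fin k₀) (Fin k₀) ℂ) (hT : T = kernelT P V) (hTunit : IsUnit T)
    -- the quantities in which the bounds are expressed
    (δ₁ δ₂ δT δ ε₁ η ε₂ ε₃ ε₄ : ℝ)
    (hδ₁ : δ₁ = specNorm (Vᴴ * V - 1)) (hδ₁small : δ₁ ≤ 1 / 3)
    (hδ₂ : δ₂ = specNorm (Pᴴ * P - 1)) (hδ₂small : δ₂ ≤ 1 / 3)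
    (hδT : δT = εT u k₀ + 3 * √(k₀ : ℝ) * εsv u k₀ * (1 + εT u k₀))
    (hδ : δ = δ₁ + δ₂)
    (hε₁ : ε₁ = δ + 2 * δT + 16 * √(k₀ : ℝ) * gammaFl u (k₀ + 1)
      + 8 * (k₀ : ℝ) * gammaFl u (k₀ + 1) ^ 2)
    (hη : η = 2 * √(specNorm T⁻¹ ^ 2 * ε₁ + specNorm T⁻¹))
    (hε₂ : ε₂ = (δT + 8 * (k₀ : ℝ) * gammaFl u (k₀ + 1) ^ 2) * η ^ 2
      + 4 * √(2 * (k₀ : ℝ)) * gammaFl u (k₀ + 1) * η)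
    (hε₃ : ε₃ = 2 * √(2 * (k₀ : ℝ)) * gammaFl u (n + 2 * k₀ + 1) * η
      + u * (√(1 + δ * η ^ 2) + ε₂))
    (hε₄ : ε₄ = ε₂ + ε₃)
    (hTsmall : δT * specNorm T⁻¹ ≤ 1 / 2) :
    specNorm (Qhatᴴ * Qhat - 1) ≤ εorth u m k
        + 2 * (δ * η ^ 2 + 2 * √((k : ℝ) * (1 + δ * η ^ 2)) * ε₄ + (k : ℝ) * ε₄ ^ 2) ∧
    frobNorm (Vᴴ * Qhat) ≤ √(2 * (k : ℝ)) *
        (2 * √(2 * (k₀ : ℝ)) * gammaFl u (k₀ + 1) + ε₁ * η + √2 * ε₃) ∧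
    specNorm (A - Qhat * Rhat - V * Shat) ≤
        (δ * η ^ 2 + (√(1 + δ * η ^ 2) + √(k : ℝ) * ε₄) ^ 2 *
          (εres u m k + δ₂ + 3 * √(k : ℝ) * ε₄ + 2 * (k₀ : ℝ) * gammaFl u k₀)) * specNorm A ∧
    -- `η = O(√κ₂(T))`, with a constant that depends only on a lower bound for `‖T‖₂`
    (∀ c : ℝ, 0 < c → c ≤ specNorm T → specCond T * ε₁ ≤ c →
      η ≤ 2 * √(2 / c) * √(specCond T)) := by
  simp only [specNorm_eq_norm] at *
  obtain ⟨hWhat, hThat, hA', hShat, ⟨horth, hres⟩, hQhat⟩ := hrun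
  simp only [specNorm_eq_norm, ← hT, ← topEmbed_mul, ← botEmbed_mul,
    ← botEmbed_conjTranspose_mul, ← topEmbed_conjTranspose_mul]
    at hWhat hThat hShat horth hres hQhat
  have hp2 : √(1 + 1 / 3) ^ 2 = (4 / 3 : ℝ) := by rw [Real.sq_sqrt (by norm_num)]; norm_num
  have hp0 : 0 ≤ √(1 + 1 / 3 : ℝ) := Real.sqrt_nonneg _
  have hps : √(1 + 1 / 3 : ℝ) ≤ √2 := Real.sqrt_le_sqrt (by norm_num)
  have hV : ‖V‖ ≤ √(1 + 1 / 3) := norm_le_of_gram (hδ₁ ▸ hδ₁small)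
  have hP : ‖P‖ ≤ √(1 + 1 / 3) := norm_le_of_gram (hδ₂ ▸ hδ₂small)
  set X := topEmbed k₀ m * P with hXdef
  have hXP : Xᴴ * X = Pᴴ * P := by
    rw [hXdef, Matrix.conjTranspose_mul, Matrix.mul_assoc, ← Matrix.mul_assoc (topEmbed k₀ m)ᴴ,
      topEmbed_gram, Matrix.one_mul]
  set W := X - V with hWdef
  have hWX : Wᴴ * X = T := by
    rw [hT, kernelT, ← topEmbed_conjTranspose_mul, hWdef, Matrix.conjTranspose_sub, Matrix.sub_mul,
      hXP, Matrix.conjTranspose_sub, Matrix.sub_mul, Matrix.conjTranspose_mul,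
      Matrix.conjTranspose_conjTranspose, Matrix.mul_assoc]
  have hVX : V = X - W := by rw [hWdef, sub_sub_cancel]
  have hWnorm : ‖W‖ ≤ √(1 + 1 / 3) + √(1 + 1 / 3) :=
    (norm_sub_le _ _).trans (add_le_add ((norm_isometry_mul topEmbed_gram P).trans_le hP) hV)
  have hW : ‖W‖ ≤ 2 * √2 := by linarith
  have hT3 : ‖T‖ ≤ 3 := by
    rw [← hWX]
    refine (specNorm_mul_le_of_le (norm_conjTranspose_le hWnorm)
      ((norm_isometry_mul topEmbed_gram P).trans_le hP)).trans ?_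
    -- ‖W‖ ‖X‖ ≤ 2 · 4/3 ≤ 3.
    nlinarith
  have hE : ‖Wᴴ * W - T - Tᴴ‖ ≤ δ := by
    refine (norm_gram_sub_kernel_le hWdef hWX).trans_eq ?_
    rw [hXP, hδ, hδ₁, hδ₂]
  have hEs : ‖Wᴴ * W - Tᴴ - Tᴴᴴ‖ ≤ δ := (norm_gram_sub_conjTranspose W T).trans_le hE
  have hn' : n = Fintype.card (Fin k₀ ⊕ Fin m) := by simp [hn]
  have hTinv := norm_inv_conjTranspose T
  have hcard : Fintype.card (Fin k₀) = k₀ := Fintype.card_fin k₀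
  obtain ⟨hY, hcolQ⟩ := hQhat.exists_blockReflector (δ := δ) (εT := εT u k₀) (δT := δT)
    (γ := gammaFl u (k₀ + 1)) (ε₁ := ε₁) (η := η) (ε₂ := ε₂) (ε₃ := ε₃) hu0 hu1 hεsv
    (W := W) hWhat hTunit hT3 hW hThat hE (by rw [hcard]) (by rw [hcard, hδT])
    (by rw [hcard, hε₁]) hη (by rw [hcard, hε₂]) (by rw [hcard, hε₃, hn']) hTsmall
  obtain ⟨hYs, hcolA⟩ := hA'.exists_blockReflector (δ := δ) (εT := εT u k₀) (δT := δT)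
    (γ := gammaFl u (k₀ + 1)) (ε₁ := ε₁) (η := η) (ε₂ := ε₂) (ε₃ := ε₃) hu0 hu1 hεsv
    (W := W) hWhat (isUnit_conjTranspose hTunit) (norm_conjTranspose_le hT3) hW
    (by rw [← Matrix.conjTranspose_sub]; exact norm_conjTranspose_le hThat) hEs
    (by rw [hcard]) (by rw [hcard, hδT]) (by rw [hcard, hε₁]) (by rw [hTinv, hη])
    (by rw [hcard, hε₂]) (by rw [hcard, hε₃, hn']) (by rwa [hTinv])
  have hγ0 := gammaFl_nonneg hu0 hu1 (k₀ + 1)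
  have hγn0 := gammaFl_nonneg hu0 hu1 (n + 2 * k₀ + 1)
  have hγk0 := gammaFl_nonneg hu0 hu1 k₀
  have hδT0 : 0 ≤ δT := by rw [hδT]; positivity
  have hη0 : 0 ≤ η := (norm_nonneg _).trans hY
  have hε₂0 : 0 ≤ ε₂ := by rw [hε₂]; positivity
  have hε₃0 : 0 ≤ ε₃ := by rw [hε₃]; positivity
  have hε₄0 : 0 ≤ ε₄ := by rw [hε₄]; positivity
  have hgram := norm_blockReflector_gram_le hTunit hE hY
  have hgram' := norm_blockReflector_gram_le (isUnit_conjTranspose hTunit) hEs hYs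
  -- The Gram bound for the reflector of Tᴴ becomes the bound on H Hᴴ - I needed for the residual.
  rw [← blockReflector_conjTranspose, Matrix.conjTranspose_conjTranspose] at hgram'
  have hQs := norm_isometry_mul (E := botEmbed k₀ m) botEmbed_gram Qs
  have hQerr : ‖Qhat - blockReflector W T * (botEmbed k₀ m * Qs)‖ ≤ √k * ε₄ * ‖Qs‖ := by
    have h := norm_sub_blockReflector_mul_le_of_columns (H := blockReflector W T) hε₂0 hε₃0
      fun j => by
        obtain ⟨W', M', -, -, -, -, h1, h2⟩ := hcolQ j
        exact ⟨_, h1, h2⟩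
    rwa [Fintype.card_fin, ← hε₄, hQs] at h
  have hAerr : ‖A' - (blockReflector W T)ᴴ * A‖ ≤ √k * ε₄ * ‖A‖ := by
    have h := norm_sub_blockReflector_mul_le_of_columns (H := blockReflector W Tᴴ) hε₂0 hε₃0
      fun j => by
        obtain ⟨W', M', -, -, -, -, h1, h2⟩ := hcolA j
        exact ⟨_, h1, h2⟩
    rwa [Fintype.card_fin, ← hε₄, ← blockReflector_conjTranspose] at h
  have hs0 : 0 ≤ √(k : ℝ) * ε₄ := by positivity
  refine ⟨?_, ?_, ?_, fun c hc hcT hcond => ?_⟩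
  · have hgramQ : ‖(botEmbed k₀ m * Qs)ᴴ * (botEmbed k₀ m * Qs) - 1‖ ≤ εorth u m k := by
      rw [Matrix.conjTranspose_mul, Matrix.mul_assoc, ← Matrix.mul_assoc (botEmbed k₀ m)ᴴ,
        botEmbed_gram, Matrix.one_mul]
      exact horth
    refine (norm_gram_sub_one_le_of_perturbed hgramQ hεorth1 hgram hs0
      (by rwa [hQs])).trans_eq ?_
    rw [Real.sqrt_mul (Nat.cast_nonneg _), mul_pow, Real.sq_sqrt (Nat.cast_nonneg _)]
    ring
  · set ω := 2 * √(2 * (k₀ : ℝ)) * gammaFl u (k₀ + 1) with hω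
    have hω0 : 0 ≤ ω := by positivity
    have hδ0 : 0 ≤ δ := (norm_nonneg _).trans hE
    -- √2 ω is only 4√k₀ γ, well within the 16√k₀ γ of ε₁.
    have hε₁' : δ + δT + √2 * ω ≤ ε₁ := by
      have h1 : √2 * ω = 4 * (√(k₀ : ℝ) * gammaFl u (k₀ + 1)) := by
        rw [hω, Real.sqrt_mul zero_le_two]
        linear_combination 2 * √(k₀ : ℝ) * gammaFl u (k₀ + 1) * Real.sq_sqrt zero_le_two
      have h2 : 0 ≤ √(k₀ : ℝ) * gammaFl u (k₀ + 1) := by positivity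
      have h3 : 0 ≤ 8 * (k₀ : ℝ) * gammaFl u (k₀ + 1) ^ 2 := by positivity
      rw [h1, hε₁]
      linarith
    have hc0 : 0 ≤ ω + ε₁ * η + √2 * ε₃ := by
      have : 0 ≤ ε₁ := le_trans (by positivity) hε₁'
      positivity
    have hcol : ∀ j, ‖colMat (Vᴴ * Qhat) j‖
        ≤ (ω + ε₁ * η + √2 * ε₃) * ‖colMat (botEmbed k₀ m * Qs) j‖ := fun j => by
      obtain ⟨W', M', hM', hY', hd, hWω, -, hz⟩ := hcolQ j
      set b := colMat (botEmbed k₀ m * Qs) j with hb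
      rw [hcard] at hWω
      have hXb : Xᴴ * b = 0 := by
        rw [hb, colMat_mul, hXdef, Matrix.conjTranspose_mul, Matrix.mul_assoc,
          ← Matrix.mul_assoc (topEmbed k₀ m)ᴴ, topEmbed_conjTranspose_mul_botEmbed,
          Matrix.zero_mul, Matrix.mul_zero]
      have h1 := norm_conjTranspose_mul_blockReflector_mul_le hM' hVX hWX hXb hE (hV.trans hps)
        hWω hd hY'
      have h2 := specNorm_mul_le_of_le (norm_conjTranspose_le (hV.trans hps)) hz
      have h3 : colMat (Vᴴ * Qhat) j = Vᴴ * (blockReflector W' M' * b)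
          + Vᴴ * (colMat Qhat j - blockReflector W' M' * b) := by
        rw [colMat_mul, ← Matrix.mul_add, add_sub_cancel]
      rw [h3]
      refine (norm_add_le _ _).trans ((add_le_add h1 h2).trans ?_)
      have h4 := mul_le_mul_of_nonneg_right (mul_le_mul_of_nonneg_right hε₁' hη0) (norm_nonneg b)
      linarith
    have hB : frobNorm (botEmbed k₀ m * Qs) ≤ √k * √2 := by
      refine (frobNorm_le_sqrt_card_mul_norm _).trans ?_
      rw [Fintype.card_fin, hQs]
      gcongr
      exact (norm_le_of_gram (horth.trans hεorth1)).trans hps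
    refine (frobNorm_le_of_forall_colMat hc0 hcol).trans
      ((mul_le_mul_of_nonneg_left hB hc0).trans_eq ?_)
    rw [Real.sqrt_mul zero_le_two]
    ring
  · have hPunit : IsUnit P :=
      isUnit_of_norm_conjTranspose_mul_self_sub_one (by rw [← hδ₂]; linarith)
    have hS : ‖V * (Shat - Pᴴ * ((topEmbed k₀ m)ᴴ * A'))‖
        ≤ 2 * (k₀ : ℝ) * gammaFl u k₀ * ‖A'‖ := by
      have h1 := hShat.norm_sub_le hu0 hu1
      rw [hcard, Matrix.l2_opNorm_conjTranspose] at h1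
      have h2 := norm_conjTranspose_isometry_mul_le (E := topEmbed k₀ m) topEmbed_gram A'
      -- ‖V‖ ‖P‖ ≤ 4/3 ≤ 2 produces the constant of 2k₀γ.
      have h3 := specNorm_mul_le_of_le hV (h1.trans (mul_le_mul (mul_le_mul_of_nonneg_left hP
        (by positivity : 0 ≤ (k₀ : ℝ) * gammaFl u k₀)) h2 (norm_nonneg _) (by positivity)))
      refine h3.trans ?_
      have h4 : 0 ≤ (k₀ : ℝ) * gammaFl u k₀ * ‖A'‖ := by positivity
      calc _ = √(1 + 1 / 3) ^ 2 * ((k₀ : ℝ) * gammaFl u k₀ * ‖A'‖) := by ring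
        _ ≤ _ := by rw [hp2]; linarith
    have h := norm_two_stage_residual_le topEmbed_gram botEmbed_gram topEmbed_add_botEmbed
      (blockReflector_mul_eq hTunit hVX hWX) hgram hgram' hs0 hAerr hQerr
      ((norm_mul_conjTranspose_sub_one hPunit).trans hδ₂.symm).le hS (by positivity)
      horth hεorth1 hεres0 hεres1 hres
    refine h.trans_eq ?_
    ring
  · rw [specCond, specNorm_eq_norm, specNorm_eq_norm] at *
    rw [hη]
    exact two_mul_sqrt_le_of_cond (norm_nonneg _) hc hcT hcond
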